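/- Let $v_1,v_2,w_1,w_2$ be points of the unit sphere $\mathbb S^2\subset\mathbb R^3$, any three of which are linearly independent, and let $D_4$ be the geodesic drawing of $K_{4,4}$ with parts $\{\pm v_1,\pm v_2\}$ and $\{\pm w_1,\pm w_2\}$, in which every edge is the shortest great-circle arc between its endpoints. Let the vertices be labelled so that the edges $v_1w_2$ and $v_2w_1$ cross (this can always be achieved by replacing some of the four points by their antipodes). Let $\alpha$ be the spherical angle at $w_2$ between the arcs $w_2v_2$ and $w_2v_1$, $\beta$ the angle at $v_2$ between $v_2w_2$ and $v_2w_1$, $\gamma$ the angle at $v_1$ between $v_1w_1$ and $v_1w_2$, and $\delta$ the angle at $w_1$ between $w_1v_1$ and $w_1v_2$. For $n\ge 1$ and $r>0$, a blowup drawing $D_4^{(n)}$ of radius $r$ is a geodesic drawing of $K_{4n,4n}$ obtained by replacing each of the eight vertices of $D_4$ by $n$ evenly spaced points on the circle of (geodesic) radius $r$ on $\mathbb S^2$ around it (each circle with an arbitrary rotation), such that no two of the $8n$ points coincide or are antipodal and no three lie on a common great circle. Its crossing graph $X_n$ has as vertices the $16n^2$ edges of the drawing, two of them being adjacent if they cross;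 its triangle density is the homomorphism density $t(K_3,X_n)=\hom(K_3,X_n)/|V(X_n)|^3$. Put $$F=\frac{3}{2^{12}\pi^2}\Bigl((2\pi-\alpha-\delta)(2\pi-\gamma-\beta)+2(\alpha^2+\beta^2+\gamma^2+\delta^2)-2\pi(\alpha+\beta+\gamma+\delta)\Bigr)+\frac{23}{3\cdot 2^{10}}.$$ Then there are constants $C$ and $r_0>0$, depending only on $D_4$, such that for every $\rho\in[0,r_0)$ there is a number $t=t_\rho(K_3)$ with $|t-F|\le C\rho$ and with the following property: for every sequence $D_4^{(1)},D_4^{(2)},\dots$ of blowup drawings of radii $r(n)>0$ with $r(n)\to\rho$, the triangle densities $t(K_3,X_n)$ of their crossing graphs converge to $t$. In particular, for blowups of fixed radius $r<r_0$ the limiting triangle density exists and equals $F+O(r)$, and it equals $F$ if $r(n)\to 0$. -/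

import Mathlib

namespace SphericalDrawing

noncomputable section

/-- Euclidean three-space; the unit sphere is the set of its vectors of norm one. -/
abbrev E3 : Type := EuclideanSpace ℝ (Fin 3)

/-- Unit vectors are in general position if any three of them (with distinct indices) are linearly
independent. As soon as there are at least three of them, this says that no two coincide or are
antipodal and that no three lie on a common great circle. -/
def GeneralPosition {ι : Type*} (p : ι → E3) : Prop :=
  ∀ i j k : ι, i ≠ j → i ≠ k → j ≠ k → LinearIndependent ℝ ![p i, p j, p k]

/-- The relative interior of the (shortest) geodesic arc between two distinct, non-antipodal points
`x` and `y` of the unit sphere. -/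
def openArc (x y : E3) : Set E3 :=
  {p | ‖p‖ = 1 ∧ ∃ s t : ℝ, 0 < s ∧ 0 < t ∧ p = s • x + t • y}

/-- The spherical angle at the point `b` of the unit sphere between the geodesic arcs from `b` to
`a` and from `b` to `c`: the angle between the tangent directions of these arcs at `b`. -/
def sphericalAngle (a b c : E3) : ℝ :=
  InnerProductGeometry.angle (a - inner ℝ a b • b) (c - inner ℝ c b • b)

/-- The crossing graph of the geodesic drawing of the complete bipartite graph whose two parts are
placed at the points `a i` and at the points `b j`. Its vertices are the edges `(i, j)` of the
bipartite graph; two different edges are adjacent if their arcs cross, that is, have a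
common interior point. -/
def crossingGraph {ι κ : Type*} (a : ι → E3) (b : κ → E3) : SimpleGraph (ι × κ) where
  Adj e f := e ≠ f ∧ (openArc (a e.1) (b e.2) ∩ openArc (a f.1) (b f.2)).Nonempty
  symm := ⟨fun _ _ h => ⟨h.1.symm, by rw [Set.inter_comm]; exact h.2⟩⟩
  loopless := ⟨fun _ h => h.1 rfl⟩

/-- The homomorphism density `t(H, G) = hom(H, G) / |G| ^ |H|`. -/
def homDensity {U V : Type*} (H : SimpleGraph U) (G : SimpleGraph V) : ℝ :=
  (Nat.card (H →g G) : ℝ) / (Nat.card V : ℝ) ^ Nat.card U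

/-- The four points `p 0, -p 0, p 1, -p 1`. -/
def withAntipodes (p : Fin 2 → E3) (x : Fin 2 × Bool) : E3 :=
  if x.2 then p x.1 else -p x.1

/-- The points `v 0, v 1, w 0, w 1` of the unit sphere define a geodesic drawing of `K_{4,4}` with
parts `{± v 0, ± v 1}` and `{± w 0, ± w 1}`. The general position condition says that no two
incident edges overlap. -/
structure IsAntipodalDrawing (v w : Fin 2 → E3) : Prop where
  norm_left : ∀ i, ‖v i‖ = 1
  norm_right : ∀ i, ‖w i‖ = 1
  generalPosition : GeneralPosition (Sum.elim v w)

/-- The points `p 0, …, p (n - 1)` are evenly spaced on the circle on the unit sphere with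
centre `c` and (geodesic) radius `r`. The rotation of the `n` points along the circle is
arbitrary: it is encoded in the choice of the orthonormal frame `c, e, f`. -/
def EvenlySpacedOnCircle (c : E3) (r : ℝ) {n : ℕ} (p : Fin n → E3) : Prop :=
  ∃ e f : E3, Orthonormal ℝ ![c, e, f] ∧ ∀ k : Fin n,
    p k = Real.cos r • c +
      Real.sin r • (Real.cos (2 * Real.pi * (k : ℝ) / (n : ℝ)) • e +
        Real.sin (2 * Real.pi * (k : ℝ) / (n : ℝ)) • f)

/-- All points of the nodes of one part, as a single family. -/
def nodePoints {n : ℕ} (P : Fin 2 × Bool → Fin n → E3) (x : (Fin 2 × Bool) × Fin n) : E3 :=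
  P x.1 x.2

/-- `P` and `Q` are the two parts of a blowup drawing of the antipodal drawing of `K_{4,4}` given
by `v` and `w`: each of the eight vertices is replaced by `n` evenly spaced points on the circle of
radius `r` around it, and all `8 n` points are in general position. -/
structure IsBlowup (v w : Fin 2 → E3) (r : ℝ) (n : ℕ) (P Q : Fin 2 × Bool → Fin n → E3) :
    Prop where
  left : ∀ x, EvenlySpacedOnCircle (withAntipodes v x) r (P x)
  right : ∀ x, EvenlySpacedOnCircle (withAntipodes w x) r (Q x)
  generalPosition : GeneralPosition (Sum.elim (nodePoints P) (nodePoints Q))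

/-- The triangle density `t(K₃, X)` of the crossing graph `X` of the drawing of `K_{4n,4n}` whose
parts are the points of the nodes `P` and of the nodes `Q`. -/
def triangleDensity {n : ℕ} (P Q : Fin 2 × Bool → Fin n → E3) : ℝ :=
  homDensity (⊤ : SimpleGraph (Fin 3)) (crossingGraph (nodePoints P) (nodePoints Q))

end

end SphericalDrawing

open Filter Topology SphericalDrawing

/-!
The triangle density is the average, over triples of edges, of the indicator that the three edges
cross pairwise, and whether two arcs cross is decided by the signs of four `3 × 3` determinants.
Grouped by the nodes of their endpoints, the triples of edges are parametrised by six points on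
circles of radius `r`, hence by six angles. The indicator is locally constant in the angles and the
radius away from the zero set of the determinants, which is a null set, so its averages over evenly
spaced angles converge to its mean over six independent uniform angles.

Replacing the radius `ρ` by `0` changes the sign of a determinant only for a set of angles of
measure `O(ρ)`: a determinant of points of three different nodes has constant sign, and one with a
repeated node is `ρ` times a trigonometric polynomial in one or two angles, up to `O(ρ ^ 2)`. At
radius `0` the latter becomes the increment of the height of a point of the circle above a great
circle through the centre. The sum over the choices between antipodal nodes then runs over products
of signs of such increments. A product of two of them is on average `1 / 3` for increments of one
height function from a common point, by exchangeability of three independent points, and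
`1 - 2 θ / π` for two height functions whose directions enclose the angle `θ`.
-/

namespace SphericalDrawing

open MeasureTheory

noncomputable section

/-! ### Determinants -/

/-- The determinant of three vectors of Euclidean three-space. -/
def det3 (x y z : E3) : ℝ := (EuclideanSpace.basisFun (Fin 3) ℝ).toBasis.det ![x, y, z]

lemma det3_eq (x y z : E3) : det3 x y z =
    x 0 * (y 1 * z 2 - y 2 * z 1) - x 1 * (y 0 * z 2 - y 2 * z 0)
      + x 2 * (y 0 * z 1 - y 1 * z 0) := by
  simp only [det3, Module.Basis.det_apply, Matrix.det_fin_three, Module.Basis.toMatrix_apply,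
    OrthonormalBasis.coe_toBasis_repr_apply, EuclideanSpace.basisFun_repr, Matrix.cons_val]
  ring

section Algebra

variable (c : ℝ) (x x' y y' z z' : E3)

lemma det3_add_left : det3 (x + x') y z = det3 x y z + det3 x' y z := by
  simp only [det3_eq, PiLp.add_apply]; ring

lemma det3_add_mid : det3 x (y + y') z = det3 x y z + det3 x y' z := by
  simp only [det3_eq, PiLp.add_apply]; ring

lemma det3_add_right : det3 x y (z + z') = det3 x y z + det3 x y z' := by
  simp only [det3_eq, PiLp.add_apply]; ring

lemma det3_sub_left : det3 (x - x') y z = det3 x y z - det3 x' y z := by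
  simp only [det3_eq, PiLp.sub_apply]; ring

lemma det3_sub_mid : det3 x (y - y') z = det3 x y z - det3 x y' z := by
  simp only [det3_eq, PiLp.sub_apply]; ring

lemma det3_sub_right : det3 x y (z - z') = det3 x y z - det3 x y z' := by
  simp only [det3_eq, PiLp.sub_apply]; ring

lemma det3_smul_left : det3 (c • x) y z = c * det3 x y z := by
  simp only [det3_eq, PiLp.smul_apply, smul_eq_mul]; ring

lemma det3_smul_mid : det3 x (c • y) z = c * det3 x y z := by
  simp only [det3_eq, PiLp.smul_apply, smul_eq_mul]; ring

lemma det3_smul_right : det3 x y (c • z) = c * det3 x y z := by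
  simp only [det3_eq, PiLp.smul_apply, smul_eq_mul]; ring

@[simp] lemma det3_self_left : det3 x x y = 0 := by
  rw [det3_eq]; ring

@[simp] lemma det3_self_right : det3 x y y = 0 := by
  rw [det3_eq]; ring

@[simp] lemma det3_self_outer : det3 x y x = 0 := by
  rw [det3_eq]; ring

lemma det3_swap_left : det3 y x z = -det3 x y z := by
  simp only [det3_eq]; ring

lemma det3_swap_right : det3 x z y = -det3 x y z := by
  simp only [det3_eq]; ring

lemma det3_rotate : det3 y z x = det3 x y z := by
  simp only [det3_eq]; ring

/-- Cramer's rule for the linear relation between four vectors of three-space. -/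
lemma det3_smul_add_det3_smul :
    det3 y y' x' • x + det3 x x' y' • y = det3 y y' x • x' + det3 x x' y • y' := by
  ext i
  fin_cases i <;> simp [det3_eq] <;> ring

end Algebra

lemma continuous_det3 {α : Type*} [TopologicalSpace α] {f g h : α → E3} (hf : Continuous f)
    (hg : Continuous g) (hh : Continuous h) : Continuous fun a => det3 (f a) (g a) (h a) := by
  simp only [det3_eq]
  fun_prop

lemma det3_ne_zero {x y z : E3} (h : LinearIndependent ℝ ![x, y, z]) : det3 x y z ≠ 0 :=
  (((EuclideanSpace.basisFun (Fin 3) ℝ).toBasis.is_basis_iff_det).1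
    ⟨h, h.span_eq_top_of_card_eq_finrank' (by simp)⟩).ne_zero

lemma abs_det3_le (x y z : E3) : |det3 x y z| ≤ ‖x‖ * ‖y‖ * ‖z‖ := by
  have : Fact (Module.finrank ℝ E3 = 3) := ⟨by simp⟩
  let b := EuclideanSpace.basisFun (Fin 3) ℝ
  have h := b.toBasis.orientation.abs_volumeForm_apply_le ![x, y, z]
  rw [b.toBasis.orientation.volumeForm_robust b rfl] at h
  simpa [det3, b, Fin.prod_univ_three] using h

/-! ### The crossing criterion -/

/-- Four signs are equal and nonzero. It is decidable, so that identities between signs can be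
checked by evaluation. -/
def SameSign (a b c d : SignType) : Prop := a ≠ 0 ∧ a = b ∧ a = c ∧ a = d

instance (a b c d : SignType) : Decidable (SameSign a b c d) := by
  unfold SameSign; infer_instance

lemma sign_eq_of_mul_eq_mul {s t a b : ℝ} (hs : 0 < s) (ht : 0 < t) (h : s * a = t * b) :
    SignType.sign a = SignType.sign b := by
  simpa only [sign_mul, sign_pos hs, sign_pos ht, one_mul] using congrArg SignType.sign h

/-- The sign condition for the arcs `p q` and `p' q'` to cross. -/
def CrossSign (p q p' q' : E3) : Prop :=
  SameSign (SignType.sign (det3 p p' q)) (SignType.sign (det3 p p' q'))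
    (SignType.sign (det3 q q' p)) (SignType.sign (det3 q q' p'))

lemma openArc_comm (x y : E3) : openArc x y = openArc y x := by
  ext p
  refine and_congr_right fun _ => ?_
  constructor <;> rintro ⟨s, t, hs, ht, h⟩ <;> exact ⟨t, s, ht, hs, by rw [h, add_comm]⟩

lemma inv_norm_smul_mem_openArc {x y : E3} {s t : ℝ} (hs : 0 < s) (ht : 0 < t)
    (h : s • x + t • y ≠ 0) :
    ‖s • x + t • y‖⁻¹ • (s • x + t • y) ∈ openArc x y := by
  have hn := norm_pos_iff.2 h
  refine ⟨by rw [norm_smul, norm_inv, norm_norm, inv_mul_cancel₀ hn.ne'],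
    ‖s • x + t • y‖⁻¹ * s, ‖s • x + t • y‖⁻¹ * t, by positivity, by positivity, ?_⟩
  rw [smul_add, smul_smul, smul_smul]

lemma openArc_inter_nonempty_of_pos {p q p' q' : E3} (h₁ : 0 < det3 p p' q)
    (h₂ : 0 < det3 p p' q') (h₃ : 0 < det3 q q' p) (h₄ : 0 < det3 q q' p') :
    (openArc p q ∩ openArc p' q').Nonempty := by
  have hrel := det3_smul_add_det3_smul p p' q q'
  have hne : det3 q q' p' • p + det3 p p' q' • q ≠ 0 := by
    intro h0
    have : det3 p p' (det3 q q' p' • p + det3 p p' q' • q) = det3 p p' q' * det3 p p' q := by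
      rw [det3_add_right, det3_smul_right, det3_smul_right, det3_self_outer, mul_zero, zero_add]
    rw [h0, ← zero_smul ℝ p, det3_smul_right, zero_mul] at this
    exact (mul_pos h₂ h₁).ne this
  refine ⟨_, inv_norm_smul_mem_openArc h₄ h₂ hne, ?_⟩
  rw [hrel] at hne ⊢
  exact inv_norm_smul_mem_openArc h₃ h₁ hne

lemma CrossSign.openArc_inter_nonempty {p q p' q' : E3} (h : CrossSign p q p' q') :
    (openArc p q ∩ openArc p' q').Nonempty := by
  obtain ⟨h0, h₂, h₃, h₄⟩ := h
  rcases lt_or_gt_of_ne (sign_ne_zero.1 h0) with h | h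
  · -- exchanging the two arcs changes all four signs
    rw [sign_neg h, eq_comm, sign_eq_neg_one_iff] at h₂ h₃ h₄
    rw [Set.inter_comm]
    apply openArc_inter_nonempty_of_pos <;> rw [det3_swap_left, neg_pos] <;> assumption
  · rw [sign_pos h, eq_comm, sign_eq_one_iff] at h₂ h₃ h₄
    exact openArc_inter_nonempty_of_pos h h₂ h₃ h₄

lemma crossSign_of_nonempty {p q p' q' : E3} (h0 : det3 p p' q ≠ 0)
    (h : (openArc p q ∩ openArc p' q').Nonempty) : CrossSign p q p' q' := by
  obtain ⟨x, ⟨-, s, t, hs, ht, hx⟩, -, s', t', hs', ht', hx'⟩ := h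
  have e : s • p + t • q = s' • p' + t' • q' := hx.symm.trans hx'
  have e₂ : t * det3 p p' q = t' * det3 p p' q' := by
    simpa [det3_add_right, det3_smul_right] using congrArg (det3 p p') e
  have e₃ : s' * det3 p p' q = t' * det3 q q' p := by
    have := congrArg (det3 p q) e
    simp only [det3_add_right, det3_smul_right, det3_self_outer, det3_self_right, mul_zero,
      add_zero] at this
    rw [det3_swap_right p p' q, ← det3_rotate p q q'] at this
    linarith
  have e₄ : s * det3 q q' p = s' * det3 q q' p' := by
    simpa [det3_add_right, det3_smul_right] using congrArg (det3 q q') e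
  have h₃ := sign_eq_of_mul_eq_mul hs' ht' e₃
  exact ⟨sign_ne_zero.2 h0, sign_eq_of_mul_eq_mul ht ht' e₂, h₃,
    h₃.trans (sign_eq_of_mul_eq_mul hs hs' e₄)⟩

lemma not_crossSign_self (p q q' : E3) : ¬CrossSign p q p q' := by
  simp [CrossSign, SameSign]

lemma openArc_inter_openArc_eq_empty {p q q' : E3} (h : det3 p q q' ≠ 0) :
    openArc p q ∩ openArc p q' = ∅ := by
  rw [Set.eq_empty_iff_forall_notMem]
  rintro x ⟨⟨-, s, t, -, ht, hx⟩, -, s', t', -, -, hx'⟩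
  have := congrArg (fun z => det3 p z q') (hx.symm.trans hx')
  simp only [det3_add_mid, det3_smul_mid, det3_self_left, det3_self_right, mul_zero,
    zero_add] at this
  exact (mul_ne_zero ht.ne' h) this

lemma crossingGraph_adj_iff {ι κ : Type*} {a : ι → E3} {b : κ → E3}
    (h : GeneralPosition (Sum.elim a b)) (e f : ι × κ) :
    (crossingGraph a b).Adj e f ↔ CrossSign (a e.1) (b e.2) (a f.1) (b f.2) := by
  obtain ⟨i, j⟩ := e
  obtain ⟨i', j'⟩ := f
  constructor
  · rintro ⟨hne, hc⟩
    by_cases hi : i = i'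
    · subst hi
      have hd := det3_ne_zero (h (.inl i) (.inr j) (.inr j') (by simp) (by simp) (by simp_all))
      exact absurd (openArc_inter_openArc_eq_empty hd) hc.ne_empty
    have hd := fun l =>
      det3_ne_zero (h (.inl i) (.inl i') (.inr l) (by simpa) (by simp) (by simp))
    by_cases hj : j = j'
    · subst hj
      rw [openArc_comm, openArc_comm (a i')] at hc
      refine absurd (openArc_inter_openArc_eq_empty ?_) hc.ne_empty
      exact (det3_rotate (b j) (a i) (a i')).symm.trans_ne (hd j)
    · exact crossSign_of_nonempty (hd j) hc
  · intro hc
    refine ⟨?_, hc.openArc_inter_nonempty⟩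
    rintro ⟨⟩
    exact not_crossSign_self _ _ _ hc

/-! ### Frames and circles -/

/-- An orthonormal frame whose first vector is the centre of a family of circles on the sphere; the
other two vectors fix the angular coordinate on these circles. -/
structure Frame where
  /-- the centre -/
  c : E3
  /-- the tangent direction of angle zero -/
  e : E3
  /-- the tangent direction of angle `π / 2` -/
  f : E3
  orthonormal : Orthonormal ℝ ![c, e, f]

lemma exists_frame {c : E3} (hc : ‖c‖ = 1) : ∃ F : Frame, F.c = c := by
  have h : Orthonormal ℝ (({0} : Set (Fin 3)).domRestrict ![c, 0, 0]) := by
    constructor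
    · rintro ⟨i, rfl⟩
      exact hc
    · rintro ⟨i, rfl⟩ ⟨j, rfl⟩ hij
      exact absurd rfl hij
  obtain ⟨b, hb⟩ := h.exists_orthonormalBasis_extension_of_card_eq (by simp)
  have h0 : b 0 = c := by simpa using hb 0 rfl
  have hbc : ![c, b 1, b 2] = b := by
    funext i
    fin_cases i
    · exact h0.symm
    · rfl
    · rfl
  exact ⟨⟨c, b 1, b 2, hbc ▸ b.orthonormal⟩, rfl⟩

namespace Frame

variable (F : Frame)

/-- The tangent direction at the centre of angle `2 * π * s`. Angles are measured in full turns, so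
that the uniform distribution of an angle is Lebesgue measure on `[0, 1)`. -/
def dir (s : ℝ) : E3 :=
  Real.cos (2 * Real.pi * s) • F.e + Real.sin (2 * Real.pi * s) • F.f

/-- The point of angle `2 * π * s` on the circle of radius `r` around the centre. -/
def pt (r s : ℝ) : E3 := Real.cos r • F.c + Real.sin r • F.dir s

lemma norm_c : ‖F.c‖ = 1 := F.orthonormal.1 0

lemma norm_e : ‖F.e‖ = 1 := F.orthonormal.1 1

lemma norm_f : ‖F.f‖ = 1 := F.orthonormal.1 2

lemma inner_ce : inner ℝ F.c F.e = 0 := F.orthonormal.2 (i := 0) (j := 1) (by decide)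

lemma inner_cf : inner ℝ F.c F.f = 0 := F.orthonormal.2 (i := 0) (j := 2) (by decide)

lemma inner_ef : inner ℝ F.e F.f = 0 := F.orthonormal.2 (i := 1) (j := 2) (by decide)

/-- The frame as an orthonormal basis. -/
def basis : OrthonormalBasis (Fin 3) ℝ E3 :=
  .mk F.orthonormal
    (F.orthonormal.linearIndependent.span_eq_top_of_card_eq_finrank' (by simp)).ge

lemma coe_basis : F.basis = ![F.c, F.e, F.f] := OrthonormalBasis.coe_mk ..

lemma expand (w : E3) :
    w = inner ℝ F.c w • F.c + inner ℝ F.e w • F.e + inner ℝ F.f w • F.f := by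
  simpa [Fin.sum_univ_three, coe_basis] using (F.basis.sum_repr' w).symm

lemma inner_of_tangent {x y : E3} (hx : inner ℝ F.c x = 0) :
    inner ℝ x y = inner ℝ F.e x * inner ℝ F.e y + inner ℝ F.f x * inner ℝ F.f y := by
  conv_lhs => rw [F.expand x, hx, zero_smul, zero_add]
  simp only [inner_add_left, real_inner_smul_left]

lemma dir_add_int (s : ℝ) (z : ℤ) : F.dir (s + z) = F.dir s := by
  rw [dir, mul_add, mul_comm (2 * Real.pi) (z : ℝ), Real.cos_add_int_mul_two_pi,
    Real.sin_add_int_mul_two_pi, dir]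

lemma norm_dir (s : ℝ) : ‖F.dir s‖ = 1 := by
  have h : ‖F.dir s‖ * ‖F.dir s‖ = 1 := by
    rw [dir, norm_add_sq_eq_norm_sq_add_norm_sq_real (by
      rw [real_inner_smul_left, real_inner_smul_right, F.inner_ef, mul_zero, mul_zero]),
      norm_smul, norm_smul, F.norm_e, F.norm_f, mul_one, mul_one, Real.norm_eq_abs,
      Real.norm_eq_abs, abs_mul_abs_self, abs_mul_abs_self, ← sq, ← sq, Real.cos_sq_add_sin_sq]
  nlinarith [norm_nonneg (F.dir s)]

lemma inner_c_dir (s : ℝ) : inner ℝ F.c (F.dir s) = 0 := by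
  rw [dir, inner_add_right, real_inner_smul_right, real_inner_smul_right, F.inner_ce, F.inner_cf,
    mul_zero, mul_zero, add_zero]

lemma norm_smul_c_add_smul_dir_sq (x y s : ℝ) : ‖x • F.c + y • F.dir s‖ ^ 2 = x ^ 2 + y ^ 2 := by
  rw [sq, norm_add_sq_eq_norm_sq_add_norm_sq_real (by
    rw [real_inner_smul_left, real_inner_smul_right, F.inner_c_dir, mul_zero, mul_zero]),
    norm_smul, norm_smul, F.norm_c, F.norm_dir, mul_one, mul_one, Real.norm_eq_abs,
    Real.norm_eq_abs, abs_mul_abs_self, abs_mul_abs_self, ← sq, ← sq]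

lemma norm_pt (r s : ℝ) : ‖F.pt r s‖ = 1 := by
  rw [← sq_eq_sq₀ (norm_nonneg _) zero_le_one, pt, F.norm_smul_c_add_smul_dir_sq,
    Real.cos_sq_add_sin_sq, one_pow]

lemma norm_pt_sub_c_le {r : ℝ} (hr : 0 ≤ r) (s : ℝ) : ‖F.pt r s - F.c‖ ≤ r := by
  have e : F.pt r s - F.c = (Real.cos r - 1) • F.c + Real.sin r • F.dir s := by
    rw [pt]; module
  rw [← sq_le_sq₀ (norm_nonneg _) hr, e, F.norm_smul_c_add_smul_dir_sq]
  linarith [Real.cos_sq_add_sin_sq r, Real.one_sub_sq_div_two_le_cos (x := r)]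

lemma pt_zero (s : ℝ) : F.pt 0 s = F.c := by simp [pt]

lemma pt_eq_add (r s s' : ℝ) : F.pt r s' = F.pt r s + Real.sin r • (F.dir s' - F.dir s) := by
  simp only [pt]; module

lemma continuous_dir {α : Type*} [TopologicalSpace α] {g : α → ℝ} (hg : Continuous g) :
    Continuous fun a => F.dir (g a) := by
  unfold dir; fun_prop

lemma continuous_pt {α : Type*} [TopologicalSpace α] {f g : α → ℝ} (hf : Continuous f)
    (hg : Continuous g) : Continuous fun a => F.pt (f a) (g a) := by
  have := F.continuous_dir hg
  unfold pt; fun_prop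

end Frame

lemma exists_polar (x y : ℝ) : ∃ φ : ℝ, x = √(x ^ 2 + y ^ 2) * Real.cos φ ∧
    y = √(x ^ 2 + y ^ 2) * Real.sin φ := by
  have h : √(x ^ 2 + y ^ 2) = ‖(⟨x, y⟩ : ℂ)‖ := by
    rw [Complex.norm_def, Complex.normSq_mk, sq, sq]
  refine ⟨Complex.arg ⟨x, y⟩, ?_⟩
  rw [h, Complex.norm_mul_cos_arg, Complex.norm_mul_sin_arg]
  exact ⟨rfl, rfl⟩

lemma exists_angle_of_orthonormal {x y x' y' : ℝ} (h : x ^ 2 + y ^ 2 = 1)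
    (h' : x' ^ 2 + y' ^ 2 = 1) (h0 : x * x' + y * y' = 0) :
    ∃ (φ : ℝ) (d : ℤˣ), x = Real.cos φ ∧ y = Real.sin φ ∧
      x' = -(d * Real.sin φ) ∧ y' = d * Real.cos φ := by
  obtain ⟨φ, hx, hy⟩ := exists_polar x y
  rw [h, Real.sqrt_one, one_mul] at hx hy
  have hx' : x' = -((x * y' - y * x') * Real.sin φ) := by
    rw [← hy]; linear_combination -x' * h + x * h0
  have hy' : y' = (x * y' - y * x') * Real.cos φ := by
    rw [← hx]; linear_combination -y' * h + y * h0
  have hdet : (x * y' - y * x') ^ 2 = 1 := by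
    linear_combination (x' ^ 2 + y' ^ 2) * h + h' - (x * x' + y * y') * h0
  rcases sq_eq_one_iff.1 hdet with hd | hd <;> rw [hd] at hx' hy'
  · exact ⟨φ, 1, hx, hy, by simpa using hx', by simpa using hy'⟩
  · exact ⟨φ, -1, hx, hy, by simpa using hx', by simpa using hy'⟩

lemma Frame.exists_rotation (F : Frame) {e f : E3} (h : Orthonormal ℝ ![F.c, e, f]) :
    ∃ (u : ℝ) (d : ℤˣ), ∀ t : ℝ,
      Real.cos (2 * Real.pi * t) • e + Real.sin (2 * Real.pi * t) • f = F.dir (u + d * t) := by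
  have he : inner ℝ F.c e = 0 := h.2 (i := 0) (j := 1) (by decide)
  have hf : inner ℝ F.c f = 0 := h.2 (i := 0) (j := 2) (by decide)
  have hee : inner ℝ e e = (1 : ℝ) := inner_self_eq_one_of_norm_eq_one (h.1 1)
  have hff : inner ℝ f f = (1 : ℝ) := inner_self_eq_one_of_norm_eq_one (h.1 2)
  have hef : inner ℝ e f = 0 := h.2 (i := 1) (j := 2) (by decide)
  rw [F.inner_of_tangent he] at hee hef
  rw [F.inner_of_tangent hf] at hff
  rw [← sq, ← sq] at hee hff
  obtain ⟨φ, d, hx, hy, hx', hy'⟩ := exists_angle_of_orthonormal hee hff hef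
  refine ⟨φ / (2 * Real.pi), d, fun t => ?_⟩
  have ht : 2 * Real.pi * (φ / (2 * Real.pi) + d * t) = φ + d * (2 * Real.pi * t) := by
    field_simp
  rw [dir, ht, Real.cos_add, Real.sin_add, F.expand e, F.expand f, he, hf, hx, hy, hx', hy']
  rcases Int.units_eq_one_or d with rfl | rfl
  · simp only [Units.val_one, Int.cast_one, one_mul]; module
  · simp only [Units.val_neg, Units.val_one, Int.cast_neg, Int.cast_one, neg_one_mul, Real.cos_neg,
      Real.sin_neg]
    module

/-- The real number `1` or `-1` by which `withAntipodes` multiplies its points. -/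
def pmOne (b : Bool) : ℝ := if b then 1 else -1

lemma withAntipodes_eq (p : Fin 2 → E3) (x : Fin 2 × Bool) :
    withAntipodes p x = pmOne x.2 • p x.1 := by
  obtain ⟨i, b⟩ := x
  cases b <;> simp [withAntipodes, pmOne]

lemma orthonormal_of_pmOne_smul {b : Bool} {c e f : E3} (h : Orthonormal ℝ ![pmOne b • c, e, f]) :
    Orthonormal ℝ ![c, pmOne b • e, pmOne b • f] := by
  cases b
  · convert h.comp_linearIsometryEquiv (LinearIsometryEquiv.neg ℝ) using 1
    funext i
    fin_cases i <;> simp [pmOne]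
  · simpa [pmOne] using h

lemma exists_perm_modEq {n : ℕ} (hn : 1 ≤ n) (d : ℤˣ) (m : ℤ) :
    ∃ π : Equiv.Perm (Fin n), ∀ k, ((π k : ℕ) : ℤ) ≡ d * (k - m) [ZMOD n] := by
  obtain ⟨n, rfl⟩ := Nat.exists_eq_succ_of_ne_zero (Nat.one_le_iff_ne_zero.1 hn)
  let π : Equiv.Perm (ZMod (n + 1)) :=
    (Equiv.subRight (m : ZMod (n + 1))).trans
      (Units.mulLeft (Units.map (Int.castRingHom _).toMonoidHom d))
  have hcast (k : Fin (n + 1)) : (((k : ℕ) : ℤ) : ZMod (n + 1)) = k := by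
    rw [Int.cast_natCast]; exact Fin.cast_val_eq_self k
  refine ⟨π, fun k => (ZMod.intCast_eq_intCast_iff _ _ _).1 ?_⟩
  rw [hcast, Int.cast_mul, Int.cast_sub, hcast]
  rfl

lemma EvenlySpacedOnCircle.exists_perm_eq_pt {F : Frame} {b : Bool} {r : ℝ} {n : ℕ} (hn : 1 ≤ n)
    {p : Fin n → E3} (h : EvenlySpacedOnCircle (pmOne b • F.c) r p) :
    ∃ (π : Equiv.Perm (Fin n)) (ψ : ℝ), ψ ∈ Set.Icc 0 (1 / (n : ℝ)) ∧
      ∀ k, p (π k) = pmOne b • F.pt r (k / n + ψ) := by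
  obtain ⟨e, f, ho, hp⟩ := h
  obtain ⟨u, d, hdir⟩ := F.exists_rotation (orthonormal_of_pmOne_smul ho)
  obtain ⟨π, hπ⟩ := exists_perm_modEq hn d ⌊n * u⌋
  have hn0 : (0 : ℝ) < n := by exact_mod_cast hn
  refine ⟨π, Int.fract (n * u) / n, ⟨div_nonneg (Int.fract_nonneg _) hn0.le,
    div_le_div_of_nonneg_right (Int.fract_lt_one _).le hn0.le⟩, fun k => ?_⟩
  obtain ⟨z, hz⟩ := (hπ k).dvd
  have hdd : ((d : ℤ) : ℝ) * d = 1 := by exact_mod_cast Int.units_coe_mul_self d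
  have hangle : u + d * ((π k : ℕ) / n) = k / n + Int.fract (n * u) / n + ((-(d * z) : ℤ) : ℝ) := by
    have hz' : (d : ℤ) * ((k : ℕ) - (⌊n * u⌋ : ℝ)) - (π k : ℕ) = n * z := by exact_mod_cast hz
    rw [Int.fract]
    generalize ⌊n * u⌋ = m at hz' ⊢
    push_cast
    field_simp
    linear_combination ((k : ℕ) - (m : ℝ)) * hdd - d * hz'
  rw [hp, Frame.pt, ← F.dir_add_int _ (-(d * z)), ← hangle, ← hdir, mul_div_assoc]
  cases b <;> simp [pmOne]

/-! ### Triangles as sign conditions -/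

section Sides

variable {ι κ σ : Type*} [DecidableEq ι]

/-- A function whose sign is, for small positive `r`, the sign of the determinant of two points of
the circles of radius `r` around the centres of `X i` and `X i'` and of a point of the circle
around the centre of `Y j`. On one circle (`i = i'`) that determinant is `sin r` times the function
below, which does not degenerate at `r = 0`. -/
def side (X : ι → Frame) (Y : κ → Frame) (r : ℝ) (i : ι) (s : ℝ) (i' : ι) (s' : ℝ) (j : κ)
    (t : ℝ) : ℝ :=
  det3 ((X i).pt r s) (if i = i' then (X i).dir s' - (X i).dir s else (X i').pt r s')
    ((Y j).pt r t)

lemma sign_det3_pt (X : ι → Frame) (Y : κ → Frame) {r : ℝ} (h0 : 0 < r) (h1 : r < Real.pi)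
    (i : ι) (s : ℝ) (i' : ι) (s' : ℝ) (j : κ) (t : ℝ) :
    SignType.sign (det3 ((X i).pt r s) ((X i').pt r s') ((Y j).pt r t)) =
      SignType.sign (side X Y r i s i' s' j t) := by
  rw [side]
  split_ifs with h
  · subst h
    rw [(X i).pt_eq_add r s s', det3_add_mid, det3_self_left, zero_add, det3_smul_mid, sign_mul,
      sign_pos (Real.sin_pos_of_pos_of_lt_pi h0 h1), one_mul]
  · rfl

/-- The signs of `side` for the end points of a family of edges: the `k`-th edge joins the node
`I k` to the node `J k`. -/
def sideSigns (X : ι → Frame) (Y : κ → Frame) (r : ℝ) (I : σ → ι) (J : σ → κ) (a b : σ → ℝ)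
    (k l m : σ) : SignType :=
  SignType.sign (side X Y r (I k) (a k) (I l) (a l) (J m) (b m))

/-- The sign of `pmOne`. -/
def pmSign (b : Bool) : SignType := if b then 1 else -1

lemma sign_pmOne (b : Bool) : SignType.sign (pmOne b) = pmSign b := by
  cases b <;> simp [pmOne, pmSign]

/-- The condition, in terms of signs of determinants, that two edges of a family cross. The end
points of the `k`-th edge are taken up to the signs `ε k` and `η k`. -/
def PairCross (ε η : σ → Bool) (D E : σ → σ → σ → SignType) (k l : σ) : Prop :=
  SameSign (pmSign (ε k) * pmSign (ε l) * pmSign (η k) * D k l k)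
    (pmSign (ε k) * pmSign (ε l) * pmSign (η l) * D k l l)
    (pmSign (η k) * pmSign (η l) * pmSign (ε k) * E k l k)
    (pmSign (η k) * pmSign (η l) * pmSign (ε l) * E k l l)

instance (ε η : σ → Bool) (D E : σ → σ → σ → SignType) (k l : σ) :
    Decidable (PairCross ε η D E k l) := by
  unfold PairCross; infer_instance

/-- The condition that three edges cross pairwise. -/
def AllCross (ε η : Fin 3 → Bool) (D E : Fin 3 → Fin 3 → Fin 3 → SignType) : Prop :=
  ∀ k l, k < l → PairCross ε η D E k l

instance (ε η : Fin 3 → Bool) (D E : Fin 3 → Fin 3 → Fin 3 → SignType) :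
    Decidable (AllCross ε η D E) := by
  unfold AllCross; infer_instance

lemma crossSign_iff_pairCross [DecidableEq κ] (X : ι → Frame) (Y : κ → Frame) {r : ℝ} (h0 : 0 < r)
    (h1 : r < Real.pi) (I : σ → ι) (J : σ → κ) (ε η : σ → Bool) (a b : σ → ℝ) (k l : σ) :
    CrossSign (pmOne (ε k) • (X (I k)).pt r (a k)) (pmOne (η k) • (Y (J k)).pt r (b k))
      (pmOne (ε l) • (X (I l)).pt r (a l)) (pmOne (η l) • (Y (J l)).pt r (b l)) ↔
    PairCross ε η (sideSigns X Y r I J a b) (sideSigns Y X r J I b a) k l := by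
  simp only [CrossSign, PairCross, sideSigns, det3_smul_left, det3_smul_mid, det3_smul_right,
    sign_mul, sign_det3_pt _ _ h0 h1, sign_pmOne, mul_assoc, mul_left_comm]

/-- The indicator of the event that three edges with given nodes and angles cross pairwise. -/
def crossWeight [DecidableEq κ] (X : ι → Frame) (Y : κ → Frame) (I : Fin 3 → ι) (J : Fin 3 → κ)
    (ε η : Fin 3 → Bool) (r : ℝ) (a b : Fin 3 → ℝ) : ℝ :=
  if AllCross ε η (sideSigns X Y r I J a b) (sideSigns Y X r J I b a) then 1 else 0

end Sides

open Classical in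
lemma natCard_top_hom {U V : Type*} [Fintype U] [LinearOrder U] [Fintype V] (G : SimpleGraph V) :
    (Nat.card ((⊤ : SimpleGraph U) →g G) : ℝ) =
      ∑ f : U → V, if ∀ k l, k < l → G.Adj (f k) (f l) then (1 : ℝ) else 0 := by
  have e : ((⊤ : SimpleGraph U) →g G) ≃ {f : U → V // ∀ k l, k < l → G.Adj (f k) (f l)} :=
    { toFun := fun φ => ⟨φ, fun k l h => φ.map_adj h.ne⟩
      invFun := fun f => ⟨f.1, fun {k l} (h : k ≠ l) => h.lt_or_gt.elim (f.2 k l)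
        fun h => (f.2 l k h).symm⟩ }
  rw [Nat.card_congr e, Nat.card_eq_fintype_card, Fintype.card_subtype, Finset.sum_boole]

lemma homDensity_congr {U V V' : Type*} (H : SimpleGraph U) {G : SimpleGraph V}
    {G' : SimpleGraph V'} (e : G ≃g G') : homDensity H G = homDensity H G' := by
  have hom : (H →g G) ≃ (H →g G') :=
    { toFun := fun φ => e.toHom.comp φ
      invFun := fun φ => e.symm.toHom.comp φ
      left_inv := fun φ => by ext x; simp
      right_inv := fun φ => by ext x; simp }
  rw [homDensity, homDensity, Nat.card_congr hom, Nat.card_congr e.toEquiv]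

/-- Relabelling the vertices of a drawing relabels its crossing graph. -/
def crossingGraphIso {ι ι' κ κ' : Type*} (a : ι → E3) (b : κ → E3) (π : ι' ≃ ι) (τ : κ' ≃ κ) :
    crossingGraph (a ∘ π) (b ∘ τ) ≃g crossingGraph a b where
  toEquiv := Equiv.prodCongr π τ
  map_rel_iff' := and_congr (Equiv.injective _).ne_iff Iff.rfl

lemma GeneralPosition.comp_injective {ι ι' : Type*} {p : ι → E3} (h : GeneralPosition p)
    {g : ι' → ι} (hg : Function.Injective g) : GeneralPosition (p ∘ g) :=
  fun _ _ _ hij hik hjk => h _ _ _ (hg.ne hij) (hg.ne hik) (hg.ne hjk)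

/-- Triples of edges, sorted into their nodes and their positions within the nodes. -/
def edgeTripleEquiv (n : ℕ) :
    (Fin 3 → ((Fin 2 × Bool) × Fin n) × ((Fin 2 × Bool) × Fin n)) ≃
      (Fin 3 → Fin 2) × (Fin 3 → Fin 2) × (Fin 3 → Bool) × (Fin 3 → Bool) × (Fin 3 → Fin n) ×
        (Fin 3 → Fin n) where
  toFun g := (fun k => (g k).1.1.1, fun k => (g k).2.1.1, fun k => (g k).1.1.2,
    fun k => (g k).2.1.2, fun k => (g k).1.2, fun k => (g k).2.2)
  invFun x k := (((x.1 k, x.2.2.1 k), x.2.2.2.2.1 k), ((x.2.1 k, x.2.2.2.1 k), x.2.2.2.2.2 k))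

lemma triangleDensity_eq_sum (X Y : Fin 2 → Frame) {r : ℝ} (h0 : 0 < r) (h1 : r < Real.pi)
    {n : ℕ} {P Q : Fin 2 × Bool → Fin n → E3} {ψ χ : Fin 2 × Bool → ℝ}
    (hP : ∀ x k, P x k = pmOne x.2 • (X x.1).pt r (k / n + ψ x))
    (hQ : ∀ x k, Q x k = pmOne x.2 • (Y x.1).pt r (k / n + χ x))
    (hg : GeneralPosition (Sum.elim (nodePoints P) (nodePoints Q))) :
    triangleDensity P Q = 1 / 2 ^ 12 * ∑ I : Fin 3 → Fin 2, ∑ J : Fin 3 → Fin 2,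
      ∑ ε : Fin 3 → Bool, ∑ η : Fin 3 → Bool,
        1 / (n : ℝ) ^ 6 * ∑ κ : Fin 3 → Fin n, ∑ μ : Fin 3 → Fin n,
          crossWeight X Y I J ε η r (fun k => κ k / n + ψ (I k, ε k))
            (fun k => μ k / n + χ (J k, η k)) := by
  classical
  have hcard : Nat.card (((Fin 2 × Bool) × Fin n) × ((Fin 2 × Bool) × Fin n)) = 16 * n ^ 2 := by
    rw [Nat.card_prod, Nat.card_prod, Nat.card_prod, Nat.card_fin, Nat.card_fin,
      Nat.card_eq_fintype_card, Fintype.card_bool]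
    ring
  have hc : ((((16 * n ^ 2 : ℕ) : ℝ)) ^ Nat.card (Fin 3))⁻¹ = 1 / 2 ^ 12 * (1 / (n : ℝ) ^ 6) := by
    rw [Nat.card_fin, Nat.cast_mul, mul_pow, mul_inv, Nat.cast_pow, ← pow_mul]
    norm_num
  rw [triangleDensity, homDensity, hcard, natCard_top_hom, ← (edgeTripleEquiv n).symm.sum_comp]
  simp only [Fintype.sum_prod_type, ← Finset.mul_sum]
  rw [← mul_assoc, div_eq_mul_inv, mul_comm, hc]
  simp only [crossWeight]
  congr! 15 with I _ J _ ε _ η _ κ _ μ _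
  refine forall₂_congr fun k l => imp_congr_right fun _ => ?_
  rw [crossingGraph_adj_iff hg, ← crossSign_iff_pairCross X Y h0 h1]
  simp only [nodePoints, edgeTripleEquiv, Equiv.coe_fn_symm_mk, hP, hQ]

lemma IsBlowup.triangleDensity_eq {v w : Fin 2 → E3} {X Y : Fin 2 → Frame}
    (hX : ∀ i, (X i).c = v i) (hY : ∀ i, (Y i).c = w i) {r : ℝ} (h0 : 0 < r)
    {n : ℕ} (hn : 1 ≤ n) {P Q : Fin 2 × Bool → Fin n → E3} (h : IsBlowup v w r n P Q) :
    ∃ ψ χ : Fin 2 × Bool → ℝ,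
      (∀ x, ψ x ∈ Set.Icc 0 (1 / (n : ℝ))) ∧ (∀ x, χ x ∈ Set.Icc 0 (1 / (n : ℝ))) ∧
      (r < Real.pi → triangleDensity P Q = 1 / 2 ^ 12 * ∑ I : Fin 3 → Fin 2, ∑ J : Fin 3 → Fin 2,
        ∑ ε : Fin 3 → Bool, ∑ η : Fin 3 → Bool,
          1 / (n : ℝ) ^ 6 * ∑ κ : Fin 3 → Fin n, ∑ μ : Fin 3 → Fin n,
            crossWeight X Y I J ε η r (fun k => κ k / n + ψ (I k, ε k))
              (fun k => μ k / n + χ (J k, η k))) := by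
  choose π ψ hψ hP using fun x : Fin 2 × Bool =>
    EvenlySpacedOnCircle.exists_perm_eq_pt (F := X x.1) (b := x.2) hn
      (by rw [hX, ← withAntipodes_eq]; exact h.left x)
  choose τ χ hχ hQ using fun x : Fin 2 × Bool =>
    EvenlySpacedOnCircle.exists_perm_eq_pt (F := Y x.1) (b := x.2) hn
      (by rw [hY, ← withAntipodes_eq]; exact h.right x)
  let πe : (Fin 2 × Bool) × Fin n ≃ (Fin 2 × Bool) × Fin n := Equiv.prodShear (Equiv.refl _) π
  let τe : (Fin 2 × Bool) × Fin n ≃ (Fin 2 × Bool) × Fin n := Equiv.prodShear (Equiv.refl _) τ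
  refine ⟨ψ, χ, hψ, hχ, fun h1 => ?_⟩
  have hg := h.generalPosition.comp_injective (πe.injective.sumMap τe.injective)
  rw [Sum.elim_comp_map] at hg
  have hreindex : triangleDensity P Q =
      triangleDensity (fun x k => P x (π x k)) (fun x k => Q x (τ x k)) :=
    (homDensity_congr _ (crossingGraphIso (nodePoints P) (nodePoints Q) πe τe)).symm
  rw [hreindex]
  exact triangleDensity_eq_sum X Y h0 h1 hP hQ hg

/-! ### Averages over evenly spaced points -/

/-- The uniform distribution of an angle, measured in full turns. -/
def turn : Measure ℝ := volume.restrict (Set.Ico 0 1)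

instance : IsProbabilityMeasure turn := ⟨by simp [turn]⟩

/-- The joint distribution of a finite family of independent uniform angles. -/
def turns (ι : Type*) [Fintype ι] : Measure (ι → ℝ) := Measure.pi fun _ => turn

instance {ι : Type*} [Fintype ι] : IsProbabilityMeasure (turns ι) := by unfold turns; infer_instance

lemma ae_turn_mem : ∀ᵐ u ∂turn, u ∈ Set.Ico (0 : ℝ) 1 := ae_restrict_mem measurableSet_Ico

lemma ae_turns_mem {ι : Type*} [Fintype ι] : ∀ᵐ a ∂turns ι, ∀ k, a k ∈ Set.Ico (0 : ℝ) 1 :=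
  ae_all_iff.2 fun k =>
    (measurePreserving_eval (fun _ : ι => turn) k).quasiMeasurePreserving.ae ae_turn_mem

section Cell

variable {ι κ : Type*} {n : ℕ} [NeZero n]

/-- The index of the interval `[k / n, (k + 1) / n)` that contains a point of `[0, 1)`. -/
def cell (n : ℕ) [NeZero n] (u : ℝ) : Fin n := Fin.ofNat n ⌊n * u⌋₊

lemma measurable_cell : Measurable (cell n) :=
  (measurable_of_countable (Fin.ofNat n)).comp (Nat.measurable_floor.comp (by fun_prop))

lemma cell_val {u : ℝ} (h : u ∈ Set.Ico (0 : ℝ) 1) : (cell n u : ℕ) = ⌊n * u⌋₊ := by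
  have hn : (0 : ℝ) < n := by exact_mod_cast NeZero.pos n
  rw [cell, Fin.val_ofNat, Nat.mod_eq_of_lt]
  rw [Nat.floor_lt (mul_nonneg hn.le h.1)]
  exact mul_lt_of_lt_one_right hn h.2

lemma cell_eq_iff {u : ℝ} (h : u ∈ Set.Ico (0 : ℝ) 1) (k : Fin n) :
    cell n u = k ↔ (k : ℝ) / n ≤ u ∧ u < ((k : ℝ) + 1) / n := by
  have hn : (0 : ℝ) < n := by exact_mod_cast NeZero.pos n
  rw [Fin.ext_iff, cell_val h, Nat.floor_eq_iff (mul_nonneg hn.le h.1), div_le_iff₀' hn,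
    lt_div_iff₀' hn]

lemma abs_cell_sub_le {u : ℝ} (h : u ∈ Set.Ico (0 : ℝ) 1) : |(cell n u : ℝ) / n - u| ≤ 1 / n := by
  obtain ⟨h1, h2⟩ := (cell_eq_iff h (cell n u)).1 rfl
  rw [add_div] at h2
  rw [abs_le]
  constructor <;> linarith [one_div_nonneg.2 (Nat.cast_nonneg (α := ℝ) n)]

lemma cell_preimage_inter (k : Fin n) :
    cell n ⁻¹' {k} ∩ Set.Ico 0 1 = Set.Ico ((k : ℝ) / n) (((k : ℝ) + 1) / n) := by
  have hn : (0 : ℝ) < n := by exact_mod_cast NeZero.pos n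
  have hk : (k : ℝ) + 1 ≤ n := by exact_mod_cast k.2
  ext u
  constructor
  · rintro ⟨hu, h⟩
    exact (cell_eq_iff h k).1 hu
  · intro hu
    have h : u ∈ Set.Ico (0 : ℝ) 1 :=
      ⟨(by positivity : (0 : ℝ) ≤ k / n).trans hu.1, hu.2.trans_le ((div_le_one hn).2 hk)⟩
    exact ⟨(cell_eq_iff h k).2 hu, h⟩

lemma map_cell_singleton (k : Fin n) : (turn.map (cell n)) {k} = ENNReal.ofReal (1 / n) := by
  rw [Measure.map_apply measurable_cell (measurableSet_singleton k), turn,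
    Measure.restrict_apply (measurable_cell (measurableSet_singleton k)), cell_preimage_inter,
    Real.volume_Ico, ← sub_div, add_sub_cancel_left]

lemma measurable_cells : Measurable fun (a : ι → ℝ) k => cell n (a k) :=
  measurable_pi_lambda _ fun k => measurable_cell.comp (measurable_pi_apply k)

lemma measurable_cells_prod [Finite ι] [Finite κ] (g : (ι → Fin n) → (κ → Fin n) → ℝ) :
    Measurable fun ω : (ι → ℝ) × (κ → ℝ) =>
      g (fun k => cell n (ω.1 k)) (fun k => cell n (ω.2 k)) :=
  (measurable_of_countable (Function.uncurry g)).comp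
    ((measurable_cells.comp measurable_fst).prodMk (measurable_cells.comp measurable_snd))

lemma map_cells_real_singleton [Fintype ι] (j : ι → Fin n) :
    ((turns ι).map fun a k => cell n (a k)).real {j} = 1 / n ^ Fintype.card ι := by
  have : IsProbabilityMeasure (turn.map (cell n)) :=
    Measure.isProbabilityMeasure_map measurable_cell.aemeasurable
  rw [turns, Measure.real, Measure.pi_map_pi (fun _ => measurable_cell.aemeasurable),
    Measure.pi_singleton]
  simp only [map_cell_singleton, Finset.prod_const, Finset.card_univ, ENNReal.toReal_pow]
  rw [ENNReal.toReal_ofReal (by positivity), div_pow, one_pow]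

variable [Fintype ι] [Fintype κ] [DecidableEq ι] [DecidableEq κ]

lemma integral_cells (g : (ι → Fin n) → ℝ) :
    ∫ a, g (fun k => cell n (a k)) ∂turns ι = 1 / (n : ℝ) ^ Fintype.card ι * ∑ j, g j := by
  have : IsProbabilityMeasure ((turns ι).map fun a k => cell n (a k)) :=
    Measure.isProbabilityMeasure_map measurable_cells.aemeasurable
  rw [← integral_map (φ := fun (a : ι → ℝ) k => cell n (a k)) (f := g)
    measurable_cells.aemeasurable
    (measurable_of_countable g).aestronglyMeasurable, integral_fintype .of_finite]
  simp only [map_cells_real_singleton, smul_eq_mul, Finset.mul_sum]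

lemma integral_cells_prod (g : (ι → Fin n) → (κ → Fin n) → ℝ) :
    ∫ ω, g (fun k => cell n (ω.1 k)) (fun k => cell n (ω.2 k)) ∂((turns ι).prod (turns κ)) =
      1 / (n : ℝ) ^ (Fintype.card ι + Fintype.card κ) * ∑ i, ∑ j, g i j := by
  obtain ⟨c, hc⟩ := (Set.finite_range (Function.uncurry g)).isBounded.exists_norm_le
  rw [integral_prod]
  · simp only [integral_cells]
    rw [integral_cells (fun i => 1 / (n : ℝ) ^ Fintype.card κ * ∑ j, g i j), ← Finset.mul_sum,
      ← mul_assoc, div_mul_div_comm, one_mul, ← pow_add]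
  · exact Integrable.of_bound (measurable_cells_prod g).aestronglyMeasurable c
      (Eventually.of_forall fun ω => hc _ ⟨(_, _), rfl⟩)

end Cell

lemma tendsto_cell_add {ι : Type*} {ψ : ℕ → ι → ℝ}
    (hψ : ∀ n : ℕ, 1 ≤ n → ∀ k, ψ n k ∈ Set.Icc 0 (1 / (n : ℝ))) {a : ι → ℝ}
    (ha : ∀ k, a k ∈ Set.Ico (0 : ℝ) 1) :
    Tendsto (fun (n : ℕ) k => (cell (n + 1) (a k) : ℝ) / ((n + 1 : ℕ) : ℝ) + ψ (n + 1) k)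
      atTop (𝓝 a) := by
  refine tendsto_pi_nhds.2 fun k => tendsto_iff_dist_tendsto_zero.2 ?_
  have h0 : Tendsto (fun n : ℕ => 2 * (1 / ((n + 1 : ℕ) : ℝ))) atTop (𝓝 0) := by
    simpa using (tendsto_one_div_add_atTop_nhds_zero_nat (𝕜 := ℝ)).const_mul 2
  refine squeeze_zero (fun _ => dist_nonneg) (fun n => ?_) h0
  have h1 := abs_le.1 (abs_cell_sub_le (n := n + 1) (ha k))
  have h2 := hψ (n + 1) (by omega) k
  rw [Real.dist_eq, abs_le]
  constructor <;> linarith [h2.1, h2.2]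

/-- Averages over equally spaced points are integrals of step functions, and these step functions
converge almost everywhere if the function is, almost everywhere, locally constant. -/
lemma tendsto_average {ι κ : Type*} [Fintype ι] [Fintype κ] [DecidableEq ι] [DecidableEq κ]
    {F : ℝ → (ι → ℝ) → (κ → ℝ) → ℝ} {ρ : ℝ} (hF : ∀ r a b, |F r a b| ≤ 1)
    (hc : ∀ᵐ ω ∂(turns ι).prod (turns κ),
      ∀ᶠ p in 𝓝 (ρ, ω.1, ω.2), F p.1 p.2.1 p.2.2 = F ρ ω.1 ω.2)
    {r : ℕ → ℝ} (hr : Tendsto r atTop (𝓝 ρ)) {ψ : ℕ → ι → ℝ} {χ : ℕ → κ → ℝ}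
    (hψ : ∀ n : ℕ, 1 ≤ n → ∀ k, ψ n k ∈ Set.Icc 0 (1 / (n : ℝ)))
    (hχ : ∀ n : ℕ, 1 ≤ n → ∀ k, χ n k ∈ Set.Icc 0 (1 / (n : ℝ))) :
    Tendsto (fun n : ℕ => 1 / (n : ℝ) ^ (Fintype.card ι + Fintype.card κ) *
      ∑ i : ι → Fin n, ∑ j : κ → Fin n,
        F (r n) (fun k => i k / n + ψ n k) (fun k => j k / n + χ n k)) atTop
      (𝓝 (∫ ω, F ρ ω.1 ω.2 ∂((turns ι).prod (turns κ)))) := by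
  rw [← tendsto_add_atTop_iff_nat 1]
  simp only [← integral_cells_prod (n := _ + 1)
    (fun i j => F _ (fun k => i k / _ + _) (fun k => j k / _ + _))]
  refine tendsto_integral_of_dominated_convergence (fun _ => 1) (fun n => ?_)
    (integrable_const _) (fun n => Eventually.of_forall fun ω => hF _ _ _) ?_
  · exact (measurable_cells_prod fun (i : ι → Fin (n + 1)) (j : κ → Fin (n + 1)) =>
      F (r (n + 1)) (fun k => i k / ((n + 1 : ℕ) : ℝ) + ψ (n + 1) k)
        (fun k => j k / ((n + 1 : ℕ) : ℝ) + χ (n + 1) k)).aestronglyMeasurable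
  · filter_upwards [hc, Measure.quasiMeasurePreserving_fst.ae ae_turns_mem,
      Measure.quasiMeasurePreserving_snd.ae ae_turns_mem] with ω h h1 h2
    refine tendsto_const_nhds.congr' ?_
    filter_upwards [((hr.comp (tendsto_add_atTop_nat 1)).prodMk_nhds
      ((tendsto_cell_add hψ h1).prodMk_nhds (tendsto_cell_add hχ h2))).eventually h] with n hn
    exact hn.symm

/-! ### Signs of increments along a circle -/

lemma coe_sign_eq_realSign (x : ℝ) : ((SignType.sign x : SignType) : ℝ) = Real.sign x := by
  rcases lt_trichotomy x 0 with h | rfl | h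
  · simp [Real.sign_of_neg h, sign_neg h]
  · simp
  · simp [Real.sign_of_pos h, sign_pos h]

lemma realSign_mul (x y : ℝ) : Real.sign (x * y) = Real.sign x * Real.sign y := by
  simp only [← coe_sign_eq_realSign, sign_mul, SignType.coe_mul]

lemma realSign_sq {x : ℝ} (h : x ≠ 0) : Real.sign x ^ 2 = 1 :=
  sq_eq_one_iff.2 (Real.sign_apply_eq_of_ne_zero x h).symm

lemma abs_realSign_le (x : ℝ) : |Real.sign x| ≤ 1 := by
  rcases Real.sign_apply_eq x with h | h | h <;> simp [h]

lemma measurable_realSign : Measurable Real.sign :=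
  Measurable.ite measurableSet_Iio measurable_const
    (Measurable.ite measurableSet_Ioi measurable_const measurable_const)

lemma integral_turn_periodic {g : ℝ → ℝ} (hg : Function.Periodic g (2 * Real.pi)) (k : ℝ) :
    ∫ x, g (2 * Real.pi * x + k) ∂turn =
      (2 * Real.pi)⁻¹ * ∫ x in (-Real.pi)..Real.pi, g x := by
  rw [turn, integral_Ico_eq_integral_Ioc, ← intervalIntegral.integral_of_le zero_le_one,
    intervalIntegral.integral_comp_mul_add g (by positivity) k, smul_eq_mul, mul_zero, zero_add,
    mul_one, add_comm (2 * Real.pi), hg.intervalIntegral_add_eq k (-Real.pi)]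
  congr 3
  ring

lemma setOf_cos_lt_cos_inter_Ioc {θ : ℝ} (h0 : 0 ≤ θ) (h1 : θ ≤ Real.pi) :
    {x | Real.cos θ < Real.cos x} ∩ Set.Ioc (-Real.pi) Real.pi = Set.Ioo (-θ) θ := by
  have hiff {x : ℝ} (hx : |x| ≤ Real.pi) : Real.cos θ < Real.cos x ↔ |x| < θ := by
    rw [← Real.cos_abs x, Real.strictAntiOn_cos.lt_iff_gt ⟨h0, h1⟩ ⟨abs_nonneg x, hx⟩]
  ext x
  constructor
  · rintro ⟨hx, hxI⟩
    exact abs_lt.1 ((hiff (abs_le.2 ⟨hxI.1.le, hxI.2⟩)).1 hx)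
  · intro hx
    have hxθ := abs_lt.2 hx
    exact ⟨(hiff (hxθ.le.trans h1)).2 hxθ, by linarith [hx.1], by linarith [hx.2]⟩

lemma turn_real_cos_lt {θ : ℝ} (h0 : 0 ≤ θ) (h1 : θ ≤ Real.pi) (k : ℝ) :
    turn.real {x | Real.cos θ < Real.cos (2 * Real.pi * x + k)} = θ / Real.pi := by
  have hS : MeasurableSet {x : ℝ | Real.cos θ < Real.cos x} :=
    measurableSet_lt measurable_const (by fun_prop)
  have hp : Function.Periodic ({x : ℝ | Real.cos θ < Real.cos x}.indicator (1 : ℝ → ℝ))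
      (2 * Real.pi) := fun x => by
    simp only [Set.indicator, Set.mem_ofPred_eq, Real.cos_add_two_pi, Pi.one_apply]
  have h := integral_turn_periodic hp k
  have e : (fun x => ({x : ℝ | Real.cos θ < Real.cos x}.indicator (1 : ℝ → ℝ))
      (2 * Real.pi * x + k)) =
      {x | Real.cos θ < Real.cos (2 * Real.pi * x + k)}.indicator (1 : ℝ → ℝ) := rfl
  rw [e, integral_indicator_one (measurableSet_lt measurable_const (by fun_prop)),
    intervalIntegral.integral_of_le (by linarith [Real.pi_pos]), integral_indicator_one hS,
    measureReal_restrict_apply hS, setOf_cos_lt_cos_inter_Ioc h0 h1,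
    Real.volume_real_Ioo_of_le (by linarith)] at h
  rw [h]
  field_simp
  ring

lemma countable_cos_eq (c k : ℝ) : {x : ℝ | Real.cos (2 * Real.pi * x + k) = c}.Countable := by
  rcases Set.eq_empty_or_nonempty {x : ℝ | Real.cos (2 * Real.pi * x + k) = c} with h | ⟨y, hy⟩
  · rw [h]; exact Set.countable_empty
  refine ((Set.countable_range fun z : ℤ => y - z).union
    (Set.countable_range fun z : ℤ => z - k / Real.pi - y)).mono fun x hx => ?_
  obtain ⟨z, hz | hz⟩ := Real.cos_eq_cos_iff.1 (Eq.trans hx (Eq.symm hy))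
  · refine .inl ⟨z, mul_left_cancel₀ Real.two_pi_pos.ne' ?_⟩
    linarith
  · refine .inr ⟨z, ?_⟩
    simp only
    field_simp
    linarith

lemma turn_countable {s : Set ℝ} (h : s.Countable) : turn s = 0 :=
  Measure.absolutelyContinuous_of_le Measure.restrict_le_self (h.measure_zero volume)

lemma turn_trig_eq_zero {B C : ℝ} (h : 0 < √(B ^ 2 + C ^ 2)) (A : ℝ) :
    turn {x | A + (B * Real.cos (2 * Real.pi * x) + C * Real.sin (2 * Real.pi * x)) = 0} = 0 := by
  obtain ⟨φ, hB, hC⟩ := exists_polar B C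
  set R := √(B ^ 2 + C ^ 2)
  refine turn_countable ((countable_cos_eq (-A / R) (-φ)).mono fun x hx => ?_)
  rw [Set.mem_ofPred_eq, hB, hC] at hx
  rw [Set.mem_ofPred_eq, eq_div_iff h.ne', ← sub_eq_add_neg, Real.cos_sub]
  linarith

lemma turn_sin_eq_zero (s : ℝ) : turn {x | Real.sin (Real.pi * (x - s)) = 0} = 0 := by
  refine turn_countable ((countable_cos_eq 1 (-(2 * Real.pi * s))).mono fun x hx => ?_)
  rw [Set.mem_ofPred_eq] at hx
  rw [Set.mem_ofPred_eq,
    show 2 * Real.pi * x + -(2 * Real.pi * s) = 2 * (Real.pi * (x - s)) by ring,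
    Real.cos_two_mul, Real.cos_sq', hx]
  norm_num

lemma integral_sign_cos_sub_cos {θ : ℝ} (h0 : 0 ≤ θ) (h1 : θ ≤ Real.pi) (k : ℝ) :
    ∫ x, Real.sign (Real.cos θ - Real.cos (2 * Real.pi * x + k)) ∂turn =
      1 - 2 * (θ / Real.pi) := by
  set S := {x : ℝ | Real.cos θ < Real.cos (2 * Real.pi * x + k)} with hS
  have hm : MeasurableSet S := measurableSet_lt measurable_const (by fun_prop)
  have e : (fun x => Real.sign (Real.cos θ - Real.cos (2 * Real.pi * x + k))) =ᵐ[turn] fun x =>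
      1 - 2 * S.indicator (1 : ℝ → ℝ) x := by
    filter_upwards [compl_mem_ae_iff.2 (turn_countable (countable_cos_eq (Real.cos θ) k))]
      with x hx
    rcases lt_or_gt_of_ne (show Real.cos (2 * Real.pi * x + k) ≠ Real.cos θ from hx) with h | h
    · rw [Real.sign_of_pos (by linarith), Set.indicator_of_notMem (by simp [hS, h.le])]
      norm_num
    · rw [Real.sign_of_neg (by linarith), Set.indicator_of_mem (by simpa [hS] using h)]
      norm_num
  have hi : Integrable (S.indicator (1 : ℝ → ℝ)) turn :=
    (integrable_indicator_iff hm).2 (integrable_const (1 : ℝ)).integrableOn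
  rw [integral_congr_ae e, integral_sub (integrable_const _) (hi.const_mul 2), integral_const_mul,
    integral_indicator_one hm, turn_real_cos_lt h0 h1, integral_const, probReal_univ, one_smul]

lemma polar_increment_eq (R φ x s : ℝ) :
    R * Real.cos φ * (Real.cos (2 * Real.pi * x) - Real.cos (2 * Real.pi * s)) +
      R * Real.sin φ * (Real.sin (2 * Real.pi * x) - Real.sin (2 * Real.pi * s)) =
    -2 * R * Real.sin (Real.pi * (x - s)) * Real.sin (Real.pi * (x + s) - φ) := by
  rw [Real.cos_sub_cos, Real.sin_sub_sin, Real.sin_sub,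
    show (2 * Real.pi * x + 2 * Real.pi * s) / 2 = Real.pi * (x + s) by ring,
    show (2 * Real.pi * x - 2 * Real.pi * s) / 2 = Real.pi * (x - s) by ring]
  ring

lemma two_mul_sin_mul_sin_eq (φ φ' x s : ℝ) :
    2 * (Real.sin (Real.pi * (x + s) - φ) * Real.sin (Real.pi * (x + s) - φ')) =
      Real.cos (φ - φ') - Real.cos (2 * Real.pi * x + (2 * Real.pi * s - φ - φ')) := by
  rw [Real.cos_sub_cos,
    show (φ - φ' + (2 * Real.pi * x + (2 * Real.pi * s - φ - φ'))) / 2 =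
      Real.pi * (x + s) - φ' by ring,
    show (φ - φ' - (2 * Real.pi * x + (2 * Real.pi * s - φ - φ'))) / 2 =
      -(Real.pi * (x + s) - φ) by ring, Real.sin_neg]
  ring

/-- By `polar_increment_eq` the product of the two signs depends on the direction of the chord
only, and with one end point fixed this direction is uniformly distributed (the inscribed angle
theorem). -/
lemma integral_sign_mul_sign_increment {B C B' C' θ : ℝ} (h0 : 0 ≤ θ) (h1 : θ ≤ Real.pi)
    (h : 0 < √(B ^ 2 + C ^ 2)) (h' : 0 < √(B' ^ 2 + C' ^ 2))
    (hθ : B * B' + C * C' = √(B ^ 2 + C ^ 2) * √(B' ^ 2 + C' ^ 2) * Real.cos θ) (s : ℝ) :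
    ∫ x, Real.sign (B * (Real.cos (2 * Real.pi * x) - Real.cos (2 * Real.pi * s)) +
        C * (Real.sin (2 * Real.pi * x) - Real.sin (2 * Real.pi * s))) *
      Real.sign (B' * (Real.cos (2 * Real.pi * x) - Real.cos (2 * Real.pi * s)) +
        C' * (Real.sin (2 * Real.pi * x) - Real.sin (2 * Real.pi * s))) ∂turn =
      1 - 2 * (θ / Real.pi) := by
  obtain ⟨φ, hB, hC⟩ := exists_polar B C
  obtain ⟨φ', hB', hC'⟩ := exists_polar B' C'
  set R := √(B ^ 2 + C ^ 2)
  set R' := √(B' ^ 2 + C' ^ 2)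
  have hc : Real.cos (φ - φ') = Real.cos θ := by
    refine mul_left_cancel₀ (mul_pos h h').ne' ?_
    rw [← hθ, hB, hC, hB', hC', Real.cos_sub]
    ring
  rw [← integral_sign_cos_sub_cos h0 h1 (2 * Real.pi * s - φ - φ')]
  refine integral_congr_ae ?_
  filter_upwards [compl_mem_ae_iff.2 (turn_sin_eq_zero s)] with x hx
  have hx' : Real.sin (Real.pi * (x - s)) ≠ 0 := hx
  have hpos : 0 < 2 * (R * R' * Real.sin (Real.pi * (x - s)) ^ 2) := by positivity
  rw [hB, hC, hB', hC', polar_increment_eq, polar_increment_eq, ← realSign_mul, ← hc,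
    ← two_mul_sin_mul_sin_eq, ← one_mul (Real.sign (2 * _)), ← Real.sign_of_pos hpos,
    ← realSign_mul]
  ring_nf

lemma turn_abs_cos_le {ε : ℝ} (h : 0 < ε) (k : ℝ) :
    turn {x | |Real.cos (Real.pi * x + k)| ≤ ε} ≤ ENNReal.ofReal (2 * ε) := by
  rcases le_or_gt (1 / 2) ε with h1 | h1
  · exact prob_le_one.trans (by rw [ENNReal.one_le_ofReal]; linarith)
  have hpi := Real.pi_pos
  have hle : 2 * Real.pi * ε ≤ Real.pi := by nlinarith
  have hc : Real.cos (2 * Real.pi * ε) < 1 - 2 * ε ^ 2 := by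
    have := Real.cos_le_one_sub_mul_cos_sq (x := 2 * Real.pi * ε) (abs_le.2 ⟨by nlinarith, hle⟩)
    have e : 2 / Real.pi ^ 2 * (2 * Real.pi * ε) ^ 2 = 8 * ε ^ 2 := by field_simp; norm_num
    nlinarith [sq_pos_of_pos h]
  have hcap := turn_real_cos_lt (by positivity) hle (2 * k + Real.pi)
  rw [show 2 * Real.pi * ε / Real.pi = 2 * ε by field_simp, Measure.real] at hcap
  rw [← hcap, ENNReal.ofReal_toReal (measure_ne_top _ _)]
  refine measure_mono fun x hx => ?_
  rw [Set.mem_ofPred_eq] at hx ⊢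
  rw [show 2 * Real.pi * x + (2 * k + Real.pi) = 2 * (Real.pi * x + k) + Real.pi by ring,
    Real.cos_add_pi, Real.cos_two_mul]
  linarith [sq_le_sq' (neg_le_of_abs_le hx) (le_of_abs_le hx)]

/-! ### Reduction to one angle -/

lemma measurePreserving_update {ι : Type*} [Fintype ι] [DecidableEq ι] {α : ι → Type*}
    [∀ i, MeasurableSpace (α i)] (μ : ∀ i, Measure (α i)) [∀ i, IsProbabilityMeasure (μ i)]
    (l : ι) :
    MeasurePreserving (fun p : α l × (∀ i, α i) => Function.update p.2 l p.1)
      ((μ l).prod (Measure.pi μ)) (Measure.pi μ) := by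
  have hm : Measurable fun p : α l × (∀ i, α i) => Function.update p.2 l p.1 := by
    refine measurable_pi_lambda _ fun i => ?_
    rcases eq_or_ne i l with rfl | hi
    · simpa only [Function.update_self] using measurable_fst
    · simp only [Function.update_of_ne hi]
      exact (measurable_pi_apply i).comp measurable_snd
  refine ⟨hm, (Measure.pi_eq fun s hs => ?_).symm⟩
  have hpre : (fun p : α l × (∀ i, α i) => Function.update p.2 l p.1) ⁻¹' Set.univ.pi s =
      s l ×ˢ Set.univ.pi (Function.update s l Set.univ) := by
    ext p
    simp only [Set.mem_preimage, Set.mem_univ_pi, Set.mem_prod]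
    rw [Function.forall_update_iff p.2 (p := fun i x => x ∈ s i),
      Function.forall_update_iff s (p := fun i t => p.2 i ∈ t)]
    simp
  rw [Measure.map_apply hm (MeasurableSet.univ_pi hs), hpre, Measure.prod_prod, Measure.pi_pi,
    ← Finset.mul_prod_erase _ _ (Finset.mem_univ l),
    ← Finset.mul_prod_erase _ _ (Finset.mem_univ l), Function.update_self, measure_univ, one_mul]
  congr 1
  refine Finset.prod_congr rfl fun i hi => ?_
  rw [Function.update_of_ne (Finset.ne_of_mem_erase hi)]

section Slices

variable {ι κ : Type*} [Fintype ι] [DecidableEq ι] [Fintype κ]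

lemma turns_le_of_slices {S : Set (ι → ℝ)} (hS : MeasurableSet S) (l : ι) {c : ENNReal}
    (h : ∀ a, turn {x | Function.update a l x ∈ S} ≤ c) : turns ι S ≤ c := by
  have e := measurePreserving_update (fun _ : ι => turn) l
  rw [turns, ← e.measure_preimage hS.nullMeasurableSet,
    Measure.prod_apply_symm (e.measurable hS)]
  exact (lintegral_mono (g := fun _ => c) h).trans (by simp)

lemma turns_prod_turns_le_of_slices {S : Set ((ι → ℝ) × (κ → ℝ))} (hS : MeasurableSet S)
    (l : ι) {c : ENNReal} (h : ∀ a b, turn {x | (Function.update a l x, b) ∈ S} ≤ c) :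
    ((turns ι).prod (turns κ)) S ≤ c := by
  rw [Measure.prod_apply_symm hS]
  refine (lintegral_mono (g := fun _ => c) fun b => ?_).trans (by simp)
  exact turns_le_of_slices (measurable_prodMk_right hS) l fun a => h a b

lemma integral_turns_eq_integral_update (l : ι) {f : (ι → ℝ) → ℝ} (hf : Integrable f (turns ι)) :
    ∫ a, f a ∂turns ι = ∫ a, ∫ x, f (Function.update a l x) ∂turn ∂turns ι := by
  have e := measurePreserving_update (fun _ : ι => turn) l
  rw [turns] at hf ⊢
  conv_lhs => rw [← e.map_eq]
  rw [integral_map e.measurable.aemeasurable (by rw [e.map_eq]; exact hf.aestronglyMeasurable)]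
  exact integral_prod_symm _ (e.integrable_comp_of_integrable hf)

end Slices

/-! ### Dependence on the radius -/

/-- The unit tangent vector orthogonal to the direction at angle `π * u`. -/
def Frame.normalDir (F : Frame) (u : ℝ) : E3 :=
  (-Real.sin (Real.pi * u)) • F.e + Real.cos (Real.pi * u) • F.f

lemma Frame.norm_normalDir (F : Frame) (u : ℝ) : ‖F.normalDir u‖ = 1 := by
  rw [← sq_eq_sq₀ (norm_nonneg _) zero_le_one, normalDir, norm_add_sq_real, norm_smul, norm_smul,
    real_inner_smul_left, real_inner_smul_right, F.norm_e, F.norm_f, F.inner_ef]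
  simp

lemma abs_det3_pt_sub_le (F G : Frame) {r : ℝ} (hr : 0 ≤ r) (s t : ℝ) {m : E3} (hm : ‖m‖ ≤ 1) :
    |det3 (F.pt r s) m (G.pt r t) - det3 F.c m G.c| ≤ 2 * r := by
  have e : det3 (F.pt r s) m (G.pt r t) - det3 F.c m G.c =
      det3 (F.pt r s - F.c) m (G.pt r t) + det3 F.c m (G.pt r t - G.c) := by
    rw [det3_sub_left, det3_sub_right]; ring
  have h1 : ‖F.pt r s - F.c‖ * ‖m‖ * ‖G.pt r t‖ ≤ r * 1 * 1 := by
    gcongr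
    exacts [F.norm_pt_sub_c_le hr s, (G.norm_pt r t).le]
  have h2 : ‖F.c‖ * ‖m‖ * ‖G.pt r t - G.c‖ ≤ 1 * 1 * r := by
    gcongr
    exacts [F.norm_c.le, G.norm_pt_sub_c_le hr t]
  rw [e]
  linarith [abs_add_le (det3 (F.pt r s - F.c) m (G.pt r t)) (det3 F.c m (G.pt r t - G.c)),
    abs_det3_le (F.pt r s - F.c) m (G.pt r t), abs_det3_le F.c m (G.pt r t - G.c)]

lemma abs_det3_pt_pt_sub_le (F F' G : Frame) {r : ℝ} (hr : 0 ≤ r) (s s' t : ℝ) :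
    |det3 (F.pt r s) (F'.pt r s') (G.pt r t) - det3 F.c F'.c G.c| ≤ 3 * r := by
  have e : det3 (F.pt r s) (F'.pt r s') (G.pt r t) - det3 F.c F'.c G.c =
      det3 (F.pt r s) (F'.pt r s' - F'.c) (G.pt r t) +
        (det3 (F.pt r s) F'.c (G.pt r t) - det3 F.c F'.c G.c) := by
    rw [det3_sub_mid]; ring
  have h1 : ‖F.pt r s‖ * ‖F'.pt r s' - F'.c‖ * ‖G.pt r t‖ ≤ 1 * r * 1 := by
    gcongr
    exacts [(F.norm_pt r s).le, F'.norm_pt_sub_c_le hr s', (G.norm_pt r t).le]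
  rw [e]
  linarith [abs_add_le (det3 (F.pt r s) (F'.pt r s' - F'.c) (G.pt r t))
      (det3 (F.pt r s) F'.c (G.pt r t) - det3 F.c F'.c G.c),
    abs_det3_pt_sub_le F G hr s t F'.norm_c.le,
    abs_det3_le (F.pt r s) (F'.pt r s' - F'.c) (G.pt r t)]

lemma sign_eq_of_abs_sub_lt {x y : ℝ} (h : |x - y| < |y|) : SignType.sign x = SignType.sign y := by
  rcases lt_trichotomy y 0 with hy | rfl | hy
  · rw [abs_of_neg hy, abs_lt] at h
    rw [sign_neg hy, sign_neg (by linarith)]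
  · exact absurd h (by simp)
  · rw [abs_of_pos hy, abs_lt] at h
    rw [sign_pos hy, sign_pos (by linarith)]

section Estimates

variable {ι κ : Type*}

/-- The centres of the frames `X` and `Y` are in general position, with the margin `m`: no `Y j`
comes close to a great circle through two centres of `X`, and none comes close to a centre of `X`
or its antipode. -/
structure Nondegenerate (X : ι → Frame) (Y : κ → Frame) (m : ℝ) : Prop where
  pos : 0 < m
  le_det3 : ∀ i i' j, i ≠ i' → m ≤ |det3 (X i).c (X i').c (Y j).c|
  le_tangent : ∀ i j, m ≤
    √(det3 (X i).c (X i).e (Y j).c ^ 2 + det3 (X i).c (X i).f (Y j).c ^ 2)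

lemma Nondegenerate.sqrt_tangent_pos {X : ι → Frame} {Y : κ → Frame} {m ρ : ℝ}
    (hN : Nondegenerate X Y m) (h0 : 0 ≤ ρ) (h1 : 3 * ρ < m) (i : ι) (s : ℝ)
    (j : κ) (t : ℝ) :
    0 < √(det3 ((X i).pt ρ s) (X i).e ((Y j).pt ρ t) ^ 2 +
      det3 ((X i).pt ρ s) (X i).f ((Y j).pt ρ t) ^ 2) := by
  have hB := abs_det3_pt_sub_le (X i) (Y j) h0 s t (X i).norm_e.le
  have hC := abs_det3_pt_sub_le (X i) (Y j) h0 s t (X i).norm_f.le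
  have hm := h1.trans_le (hN.le_tangent i j)
  rw [Real.lt_sqrt (by positivity)] at hm
  refine Real.sqrt_pos.2 ((by positivity : (0 : ℝ) ≤ _).lt_of_ne fun h => ?_)
  obtain ⟨hB0, hC0⟩ := (add_eq_zero_iff_of_nonneg (sq_nonneg _) (sq_nonneg _)).1 h.symm
  rw [pow_eq_zero_iff two_ne_zero] at hB0 hC0
  rw [hB0, zero_sub, abs_neg] at hB
  rw [hC0, zero_sub, abs_neg] at hC
  nlinarith [sq_le_sq' (neg_le_of_abs_le hB) (le_of_abs_le hB),
    sq_le_sq' (neg_le_of_abs_le hC) (le_of_abs_le hC)]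

variable [DecidableEq ι]

lemma side_same (X : ι → Frame) (Y : κ → Frame) (r : ℝ) (i : ι) (s s' : ℝ) (j : κ) (t : ℝ) :
    side X Y r i s i s' j t =
      det3 ((X i).pt r s) (X i).e ((Y j).pt r t) *
        (Real.cos (2 * Real.pi * s') - Real.cos (2 * Real.pi * s)) +
      det3 ((X i).pt r s) (X i).f ((Y j).pt r t) *
        (Real.sin (2 * Real.pi * s') - Real.sin (2 * Real.pi * s)) := by
  simp only [side, if_true, Frame.dir, det3_sub_mid, det3_add_mid, det3_smul_mid]
  ring

lemma side_self (X : ι → Frame) (Y : κ → Frame) (r : ℝ) (i : ι) (s : ℝ) (j : κ) (t : ℝ) :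
    side X Y r i s i s j t = 0 := by
  simp [side_same]

lemma side_same_eq_mul (X : ι → Frame) (Y : κ → Frame) (r : ℝ) (i : ι) (s s' : ℝ) (j : κ)
    (t : ℝ) :
    side X Y r i s i s' j t = 2 * Real.sin (Real.pi * (s' - s)) *
      det3 ((X i).pt r s) ((X i).normalDir (s' + s)) ((Y j).pt r t) := by
  rw [side_same, Real.cos_sub_cos, Real.sin_sub_sin, Frame.normalDir, det3_add_mid,
    det3_smul_mid, det3_smul_mid,
    show (2 * Real.pi * s' + 2 * Real.pi * s) / 2 = Real.pi * (s' + s) by ring,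
    show (2 * Real.pi * s' - 2 * Real.pi * s) / 2 = Real.pi * (s' - s) by ring]
  ring

lemma side_zero_of_ne (X : ι → Frame) (Y : κ → Frame) {i i' : ι} (h : i ≠ i') (s s' : ℝ) (j : κ)
    (t : ℝ) : side X Y 0 i s i' s' j t = det3 (X i).c (X i').c (Y j).c := by
  simp [side, h, Frame.pt_zero]

namespace Nondegenerate

variable {X : ι → Frame} {Y : κ → Frame} {m ρ : ℝ}

lemma sign_side_of_ne (hN : Nondegenerate X Y m) (h0 : 0 ≤ ρ) (h1 : 3 * ρ < m)
    {i i' : ι} (h : i ≠ i') (s s' : ℝ) (j : κ) (t : ℝ) :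
    SignType.sign (side X Y ρ i s i' s' j t) = SignType.sign (side X Y 0 i s i' s' j t) := by
  rw [side_zero_of_ne X Y h, side, if_neg h]
  exact sign_eq_of_abs_sub_lt ((abs_det3_pt_pt_sub_le _ _ _ h0 s s' t).trans_lt
    (h1.trans_le (hN.le_det3 i i' j h)))

lemma side_zero_ne_zero_of_ne (hN : Nondegenerate X Y m) {i i' : ι} (h : i ≠ i') (s s' : ℝ)
    (j : κ) (t : ℝ) : side X Y 0 i s i' s' j t ≠ 0 := by
  rw [side_zero_of_ne X Y h, ← abs_pos]
  exact hN.pos.trans_le (hN.le_det3 i i' j h)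

lemma side_ne_zero_of_ne (hN : Nondegenerate X Y m) (h0 : 0 ≤ ρ) (h1 : 3 * ρ < m) {i i' : ι}
    (h : i ≠ i') (s s' : ℝ) (j : κ) (t : ℝ) : side X Y ρ i s i' s' j t ≠ 0 := by
  rw [← sign_ne_zero, hN.sign_side_of_ne h0 h1 h, sign_ne_zero]
  exact hN.side_zero_ne_zero_of_ne h s s' j t

lemma turn_side_eq_zero (hN : Nondegenerate X Y m) (h0 : 0 ≤ ρ) (h1 : 3 * ρ < m)
    (i : ι) (s : ℝ) (i' : ι) (j : κ) (t : ℝ) :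
    turn {x | side X Y ρ i s i' x j t = 0} = 0 := by
  rcases eq_or_ne i i' with rfl | h
  · refine measure_mono_null (fun x hx => ?_) (turn_trig_eq_zero (hN.sqrt_tangent_pos h0 h1 i s j t)
      (-(det3 ((X i).pt ρ s) (X i).e ((Y j).pt ρ t) * Real.cos (2 * Real.pi * s) +
        det3 ((X i).pt ρ s) (X i).f ((Y j).pt ρ t) * Real.sin (2 * Real.pi * s))))
    rw [Set.mem_ofPred_eq, side_same] at hx
    rw [Set.mem_ofPred_eq]
    linarith
  · simp [hN.side_ne_zero_of_ne h0 h1 h]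

lemma turn_sign_side_same_ne_le (hN : Nondegenerate X Y m) (h0 : 0 < ρ) (i : ι) (s : ℝ) (j : κ)
    (t : ℝ) :
    turn {x | SignType.sign (side X Y ρ i s i x j t) ≠ SignType.sign (side X Y 0 i s i x j t)} ≤
      ENNReal.ofReal (4 / m * ρ) := by
  obtain ⟨φ, hC, hB⟩ := exists_polar (det3 (X i).c (X i).f (Y j).c) (det3 (X i).c (X i).e (Y j).c)
  have hmR := hN.le_tangent i j
  rw [add_comm] at hmR
  set R := √(det3 (X i).c (X i).f (Y j).c ^ 2 + det3 (X i).c (X i).e (Y j).c ^ 2)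
  have hm := hN.pos
  have hR : 0 < R := hm.trans_le hmR
  have hnormal : ∀ x, det3 (X i).c ((X i).normalDir (x + s)) (Y j).c =
      R * Real.cos (Real.pi * x + (Real.pi * s + φ)) := fun x => by
    rw [Frame.normalDir, det3_add_mid, det3_smul_mid, det3_smul_mid, hC, hB, ← add_assoc,
      Real.cos_add (_ + _), mul_add]
    ring
  calc turn {x | SignType.sign (side X Y ρ i s i x j t) ≠ SignType.sign (side X Y 0 i s i x j t)}
      ≤ turn {x | |Real.cos (Real.pi * x + (Real.pi * s + φ))| ≤ 2 * ρ / R} := by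
        refine measure_mono fun x hx => ?_
        rw [Set.mem_ofPred_eq] at hx ⊢
        contrapose! hx
        rw [side_same_eq_mul, side_same_eq_mul, sign_mul, sign_mul (2 * _), Frame.pt_zero,
          Frame.pt_zero]
        congr 1
        refine sign_eq_of_abs_sub_lt
          ((abs_det3_pt_sub_le _ _ h0.le _ _ ((X i).norm_normalDir _).le).trans_lt ?_)
        rwa [hnormal, abs_mul, abs_of_pos hR, ← div_lt_iff₀' hR]
    _ ≤ ENNReal.ofReal (2 * (2 * ρ / R)) := turn_abs_cos_le (by positivity) _
    _ ≤ ENNReal.ofReal (4 / m * ρ) := by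
        refine ENNReal.ofReal_le_ofReal ?_
        rw [show 2 * (2 * ρ / R) = 4 / R * ρ by ring]
        gcongr

lemma turn_sign_side_ne_le (hN : Nondegenerate X Y m) (h0 : 0 ≤ ρ) (h1 : 3 * ρ < m)
    (i : ι) (s : ℝ) (i' : ι) (j : κ) (t : ℝ) :
    turn {x | SignType.sign (side X Y ρ i s i' x j t) ≠ SignType.sign (side X Y 0 i s i' x j t)} ≤
      ENNReal.ofReal (4 / m * ρ) := by
  rcases h0.eq_or_lt with rfl | hρ
  · simp
  rcases eq_or_ne i i' with rfl | h
  · exact hN.turn_sign_side_same_ne_le hρ i s j t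
  · simp [hN.sign_side_of_ne h0 h1 h]

end Nondegenerate

lemma continuous_side (X : ι → Frame) (Y : κ → Frame) (i i' : ι) (j : κ) :
    Continuous fun p : ℝ × ℝ × ℝ × ℝ => side X Y p.1 i p.2.1 i' p.2.2.1 j p.2.2.2 := by
  have hpt (F : Frame) {g : ℝ × ℝ × ℝ × ℝ → ℝ} (hg : Continuous g) :
      Continuous fun p : ℝ × ℝ × ℝ × ℝ => F.pt p.1 (g p) := F.continuous_pt continuous_fst hg
  unfold side
  split_ifs
  · exact continuous_det3 (hpt _ (by fun_prop))
      (((X i).continuous_dir (by fun_prop)).sub ((X i).continuous_dir (by fun_prop)))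
      (hpt _ (by fun_prop))
  · exact continuous_det3 (hpt _ (by fun_prop)) (hpt _ (by fun_prop)) (hpt _ (by fun_prop))

end Estimates

/-! ### Random triples of edges -/

instance : MeasurableSpace SignType := ⊤

instance : DiscreteMeasurableSpace SignType := ⟨fun _ => trivial⟩

lemma measurable_sign : Measurable (SignType.sign : ℝ → SignType) := by
  refine measurable_to_countable' fun s => ?_
  rcases s with _ | _ | _
  · convert measurableSet_singleton (0 : ℝ) using 1
    ext x; exact sign_eq_zero_iff
  · convert measurableSet_Iio (a := (0 : ℝ)) using 1
    ext x; exact sign_eq_neg_one_iff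
  · convert measurableSet_Ioi (a := (0 : ℝ)) using 1
    ext x; exact sign_eq_one_iff

/-- The angles of the end points of three edges, in turns: the first component is for the end
points in the part `X`, the second for those in the part `Y`. -/
abbrev Params : Type := (Fin 3 → ℝ) × (Fin 3 → ℝ)

/-- The distribution of the angles of three random edges: six independent uniform turns. -/
abbrev params : Measure Params := (turns (Fin 3)).prod (turns (Fin 3))

lemma measurePreserving_swap_params : MeasurePreserving Prod.swap params params :=
  Measure.measurePreserving_swap

section Params

variable {ι κ : Type*} [DecidableEq ι]

lemma continuous_side_params (X : ι → Frame) (Y : κ → Frame) (I : Fin 3 → ι) (J : Fin 3 → κ)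
    (k l n : Fin 3) :
    Continuous fun p : ℝ × Params =>
      side X Y p.1 (I k) (p.2.1 k) (I l) (p.2.1 l) (J n) (p.2.2 n) :=
  (continuous_side X Y (I k) (I l) (J n)).comp
    (f := fun p : ℝ × Params => (p.1, p.2.1 k, p.2.1 l, p.2.2 n)) (by fun_prop)

lemma measurable_sideSigns (X : ι → Frame) (Y : κ → Frame) (r : ℝ) (I : Fin 3 → ι)
    (J : Fin 3 → κ) :
    Measurable fun ω : Params => sideSigns X Y r I J ω.1 ω.2 :=
  measurable_pi_lambda _ fun k => measurable_pi_lambda _ fun l => measurable_pi_lambda _ fun n =>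
    measurable_sign.comp ((continuous_side_params X Y I J k l n).comp
      (f := fun ω : Params => (r, ω)) (by fun_prop)).measurable

lemma eventually_sideSigns_eq (X : ι → Frame) (Y : κ → Frame) (I : Fin 3 → ι) (J : Fin 3 → κ)
    {ρ : ℝ} {a b : Fin 3 → ℝ}
    (h : ∀ k l n, k ≠ l → side X Y ρ (I k) (a k) (I l) (a l) (J n) (b n) ≠ 0) :
    ∀ᶠ p in 𝓝 (ρ, a, b), sideSigns X Y p.1 I J p.2.1 p.2.2 = sideSigns X Y ρ I J a b := by
  simp only [funext_iff, eventually_all]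
  intro k l n
  rcases eq_or_ne k l with rfl | hkl
  · simp [sideSigns, side_self]
  · have hsign := (continuousAt_sign_of_ne_zero (h k l n hkl)).tendsto
    rw [nhds_discrete SignType, tendsto_pure] at hsign
    exact ((continuous_side_params X Y I J k l n).tendsto (ρ, a, b)).eventually hsign

section CrossWeight

variable [DecidableEq κ] (X : ι → Frame) (Y : κ → Frame) (I : Fin 3 → ι) (J : Fin 3 → κ)
  (ε η : Fin 3 → Bool) (r : ℝ)

lemma abs_crossWeight_le (a b : Fin 3 → ℝ) : |crossWeight X Y I J ε η r a b| ≤ 1 := by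
  unfold crossWeight; split_ifs <;> simp

lemma measurable_crossWeight :
    Measurable fun ω : Params => crossWeight X Y I J ε η r ω.1 ω.2 := by
  have : MeasurableSingletonClass (Fin 3 → Fin 3 → Fin 3 → SignType) :=
    Pi.instMeasurableSingletonClass
  exact (measurable_of_countable fun p : (Fin 3 → Fin 3 → Fin 3 → SignType) ×
    (Fin 3 → Fin 3 → Fin 3 → SignType) => if AllCross ε η p.1 p.2 then (1 : ℝ) else 0).comp
    ((measurable_sideSigns X Y r I J).prodMk
      ((measurable_sideSigns Y X r J I).comp measurable_swap))

lemma integrable_crossWeight :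
    Integrable (fun ω => crossWeight X Y I J ε η r ω.1 ω.2) params :=
  Integrable.of_bound (measurable_crossWeight X Y I J ε η r).aestronglyMeasurable 1
    (Eventually.of_forall fun ω => abs_crossWeight_le X Y I J ε η r ω.1 ω.2)

end CrossWeight

namespace Nondegenerate

variable {X : ι → Frame} {Y : κ → Frame} {m ρ : ℝ}

lemma ae_side_ne_zero (hN : Nondegenerate X Y m) (h0 : 0 ≤ ρ) (h1 : 3 * ρ < m)
    (I : Fin 3 → ι) (J : Fin 3 → κ) :
    ∀ᵐ ω ∂params, ∀ k l n, k ≠ l →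
      side X Y ρ (I k) (ω.1 k) (I l) (ω.1 l) (J n) (ω.2 n) ≠ 0 := by
  simp only [ae_all_iff]
  intro k l n hkl
  rw [ae_iff]
  simp only [not_not]
  refine le_antisymm (turns_prod_turns_le_of_slices ?_ l fun a b => ?_) zero_le
  · exact (measurableSet_singleton (0 : ℝ)).preimage ((continuous_side_params X Y I J k l n).comp
      (f := fun ω : Params => (ρ, ω)) (by fun_prop)).measurable
  · have := hN.turn_side_eq_zero h0 h1 (I k) (a k) (I l) (J n) (b n)
    simpa [Function.update_of_ne hkl] using this.le

lemma params_real_sideSigns_ne_le (hN : Nondegenerate X Y m) (h0 : 0 ≤ ρ) (h1 : 3 * ρ < m)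
    (I : Fin 3 → ι) (J : Fin 3 → κ) :
    params.real {ω : Params | sideSigns X Y ρ I J ω.1 ω.2 ≠ sideSigns X Y 0 I J ω.1 ω.2} ≤
      27 * (4 / m * ρ) := by
  have hm := hN.pos
  have hentry : ∀ k l n, params.real {ω : Params | sideSigns X Y ρ I J ω.1 ω.2 k l n ≠
      sideSigns X Y 0 I J ω.1 ω.2 k l n} ≤ 4 / m * ρ := fun k l n => by
    refine ENNReal.toReal_le_of_le_ofReal (by positivity) ?_
    rcases eq_or_ne k l with rfl | hkl
    · simp [sideSigns, side_self]
    have hmeas (r : ℝ) : Measurable fun ω : Params =>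
        sideSigns X Y r I J ω.1 ω.2 k l n :=
      (measurable_pi_apply n).comp ((measurable_pi_apply l).comp ((measurable_pi_apply k).comp
        (measurable_sideSigns X Y r I J)))
    refine turns_prod_turns_le_of_slices (measurableSet_eq_fun (hmeas ρ) (hmeas 0)).compl l
      fun a b => ?_
    have := hN.turn_sign_side_ne_le h0 h1 (I k) (a k) (I l) (J n) (b n)
    simpa [sideSigns, Function.update_of_ne hkl] using this
  have hunion : {ω : Params | sideSigns X Y ρ I J ω.1 ω.2 ≠ sideSigns X Y 0 I J ω.1 ω.2} =
      ⋃ x : Fin 3 × Fin 3 × Fin 3, {ω : Params | sideSigns X Y ρ I J ω.1 ω.2 x.1 x.2.1 x.2.2 ≠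
        sideSigns X Y 0 I J ω.1 ω.2 x.1 x.2.1 x.2.2} := by
    ext ω
    simp [funext_iff]
  rw [hunion]
  refine (measureReal_iUnion_fintype_le _).trans
    ((Finset.sum_le_sum fun x _ => hentry x.1 x.2.1 x.2.2).trans ?_)
  norm_num

variable [DecidableEq κ]

lemma ae_eventually_crossWeight_eq (hX : Nondegenerate X Y m) (hY : Nondegenerate Y X m)
    (h0 : 0 ≤ ρ) (h1 : 3 * ρ < m) (I : Fin 3 → ι) (J : Fin 3 → κ) (ε η : Fin 3 → Bool) :
    ∀ᵐ ω ∂params, ∀ᶠ p in 𝓝 (ρ, ω.1, ω.2),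
      crossWeight X Y I J ε η p.1 p.2.1 p.2.2 = crossWeight X Y I J ε η ρ ω.1 ω.2 := by
  filter_upwards [hX.ae_side_ne_zero h0 h1 I J,
    measurePreserving_swap_params.quasiMeasurePreserving.ae (hY.ae_side_ne_zero h0 h1 J I)]
    with ω hωX hωY
  have hswap : Continuous fun p : ℝ × Params => (p.1, p.2.swap) := by fun_prop
  filter_upwards [eventually_sideSigns_eq X Y I J hωX,
    (hswap.tendsto (ρ, ω)).eventually (eventually_sideSigns_eq Y X J I hωY)] with p hpX hpY
  rw [crossWeight, crossWeight, hpX]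
  exact congrArg (fun E => if AllCross ε η _ E then (1 : ℝ) else 0) hpY

lemma abs_integral_crossWeight_sub_le (hX : Nondegenerate X Y m) (hY : Nondegenerate Y X m)
    (h0 : 0 ≤ ρ) (h1 : 3 * ρ < m) (I : Fin 3 → ι) (J : Fin 3 → κ) (ε η : Fin 3 → Bool) :
    |∫ ω, crossWeight X Y I J ε η ρ ω.1 ω.2 ∂params -
      ∫ ω, crossWeight X Y I J ε η 0 ω.1 ω.2 ∂params| ≤ 216 / m * ρ := by
  set S := {ω : Params | sideSigns X Y ρ I J ω.1 ω.2 ≠ sideSigns X Y 0 I J ω.1 ω.2} with hS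
  set T := {ω : Params | sideSigns Y X ρ J I ω.1 ω.2 ≠ sideSigns Y X 0 J I ω.1 ω.2} with hT
  have hT' : params.real (Prod.swap ⁻¹' T) = params.real T :=
    congrArg ENNReal.toReal (MeasurePreserving.measure_preimage_equiv
      (f := MeasurableEquiv.prodComm) measurePreserving_swap_params T)
  have hzero : ∀ ω ∉ S ∪ Prod.swap ⁻¹' T,
      crossWeight X Y I J ε η ρ ω.1 ω.2 - crossWeight X Y I J ε η 0 ω.1 ω.2 = 0 := fun ω hω => by
    simp only [hS, hT, Set.mem_union, Set.mem_preimage, Set.mem_ofPred_eq, not_or, not_not,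
      Prod.fst_swap, Prod.snd_swap] at hω
    rw [crossWeight, crossWeight, hω.1, hω.2, sub_self]
  rw [← integral_sub (integrable_crossWeight X Y I J ε η ρ) (integrable_crossWeight X Y I J ε η 0),
    ← setIntegral_eq_integral_of_forall_compl_eq_zero hzero, ← Real.norm_eq_abs]
  calc ‖∫ ω in S ∪ Prod.swap ⁻¹' T,
        (crossWeight X Y I J ε η ρ ω.1 ω.2 - crossWeight X Y I J ε η 0 ω.1 ω.2) ∂params‖
      ≤ 1 * params.real (S ∪ Prod.swap ⁻¹' T) := by
        refine norm_setIntegral_le_of_norm_le_const (measure_lt_top _ _) fun ω _ => ?_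
        unfold crossWeight
        split_ifs <;> norm_num
    _ ≤ params.real S + params.real T := by
        rw [one_mul, ← hT']; exact measureReal_union_le _ _
    _ ≤ 27 * (4 / m * ρ) + 27 * (4 / m * ρ) :=
        add_le_add (hX.params_real_sideSigns_ne_le h0 h1 I J)
          (hY.params_real_sideSigns_ne_le h0 h1 J I)
    _ = 216 / m * ρ := by ring

end Nondegenerate

end Params

/-! ### The limit of the triangle densities -/

/-- The limit of the triangle densities of blowup drawings whose radii tend to `ρ`. -/
def limitDensity (X Y : Fin 2 → Frame) (ρ : ℝ) : ℝ :=
  1 / 2 ^ 12 * ∑ I : Fin 3 → Fin 2, ∑ J : Fin 3 → Fin 2, ∑ ε : Fin 3 → Bool, ∑ η : Fin 3 → Bool,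
    ∫ ω, crossWeight X Y I J ε η ρ ω.1 ω.2 ∂params

section LimitDensity

variable {X Y : Fin 2 → Frame} {m ρ : ℝ}

lemma tendsto_triangleDensity (hX : Nondegenerate X Y m) (hY : Nondegenerate Y X m)
    (h0 : 0 ≤ ρ) (h1 : 3 * ρ < m) (h2 : ρ < Real.pi) {v w : Fin 2 → E3}
    (hv : ∀ i, (X i).c = v i) (hw : ∀ i, (Y i).c = w i) {r : ℕ → ℝ}
    {P Q : (n : ℕ) → Fin 2 × Bool → Fin n → E3} (hr : ∀ n, 1 ≤ n → 0 < r n)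
    (hρ : Tendsto r atTop (𝓝 ρ)) (hB : ∀ n, 1 ≤ n → IsBlowup v w (r n) n (P n) (Q n)) :
    Tendsto (fun n => triangleDensity (P n) (Q n)) atTop (𝓝 (limitDensity X Y ρ)) := by
  choose! ψ χ hψ hχ heq using fun n (hn : 1 ≤ n) =>
    (hB n hn).triangleDensity_eq hv hw (hr n hn) hn
  have hlim : Tendsto (fun n : ℕ => 1 / 2 ^ 12 * ∑ I : Fin 3 → Fin 2, ∑ J : Fin 3 → Fin 2,
      ∑ ε : Fin 3 → Bool, ∑ η : Fin 3 → Bool,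
        1 / (n : ℝ) ^ 6 * ∑ κ : Fin 3 → Fin n, ∑ μ : Fin 3 → Fin n,
          crossWeight X Y I J ε η (r n) (fun k => κ k / n + ψ n (I k, ε k))
            (fun k => μ k / n + χ n (J k, η k))) atTop (𝓝 (limitDensity X Y ρ)) :=
    Tendsto.const_mul _ <| tendsto_finsetSum _ fun I _ => tendsto_finsetSum _ fun J _ =>
      tendsto_finsetSum _ fun ε _ => tendsto_finsetSum _ fun η _ =>
        tendsto_average (F := crossWeight X Y I J ε η) (abs_crossWeight_le X Y I J ε η)
          (hX.ae_eventually_crossWeight_eq hY h0 h1 I J ε η) hρ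
          (ψ := fun n k => ψ n (I k, ε k)) (χ := fun n k => χ n (J k, η k))
          (fun n hn k => hψ n hn _) (fun n hn k => hχ n hn _)
  refine hlim.congr' ?_
  filter_upwards [eventually_ge_atTop 1, hρ.eventually_lt_const h2] with n hn hn'
  exact (heq n hn hn').symm

lemma abs_sum_sub_sum_le {ι : Type*} [Fintype ι] {f g : ι → ℝ} {c : ℝ}
    (h : ∀ i, |f i - g i| ≤ c) : |∑ i, f i - ∑ i, g i| ≤ Fintype.card ι * c := by
  rw [← Finset.sum_sub_distrib]
  refine (Finset.abs_sum_le_sum_abs _ _).trans ((Finset.sum_le_sum fun i _ => h i).trans ?_)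
  simp

lemma abs_limitDensity_sub_le (hX : Nondegenerate X Y m) (hY : Nondegenerate Y X m)
    (h0 : 0 ≤ ρ) (h1 : 3 * ρ < m) :
    |limitDensity X Y ρ - limitDensity X Y 0| ≤ 216 / m * ρ := by
  have hsum := abs_sum_sub_sum_le fun I : Fin 3 → Fin 2 =>
    abs_sum_sub_sum_le fun J : Fin 3 → Fin 2 => abs_sum_sub_sum_le fun ε : Fin 3 → Bool =>
      abs_sum_sub_sum_le fun η : Fin 3 → Bool =>
        hX.abs_integral_crossWeight_sub_le hY h0 h1 I J ε η
  rw [limitDensity, limitDensity, ← mul_sub, abs_mul]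
  refine (mul_le_mul_of_nonneg_left hsum (abs_nonneg _)).trans_eq ?_
  norm_num [Fintype.card_pi]
  ring

end LimitDensity

/-! ### Expectations of signs of differences -/

section Increments

variable {ι : Type*}

/-- The sign of the increment of the function `H` of an angle from the `k`-th to the `l`-th of a
family of angles. -/
def incr (H : ℝ → ℝ) (k l : ι) (a : ι → ℝ) : ℝ := Real.sign (H (a l) - H (a k))

variable {H H' : ℝ → ℝ} {τ : ℝ} {k l m : ι}

lemma incr_swap (H : ℝ → ℝ) (k l : ι) (a : ι → ℝ) : incr H l k a = -incr H k l a := by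
  rw [incr, incr, ← Real.sign_neg, neg_sub]

lemma abs_incr_le (H : ℝ → ℝ) (k l : ι) (a : ι → ℝ) : |incr H k l a| ≤ 1 := abs_realSign_le _

lemma realSign_sub_mul_realSign_sub_add {x y z : ℝ} (hxy : x ≠ y) (hxz : x ≠ z) (hyz : y ≠ z) :
    Real.sign (y - x) * Real.sign (z - x) + Real.sign (x - y) * Real.sign (z - y) +
      Real.sign (x - z) * Real.sign (y - z) = 1 := by
  have pos : ∀ {u v : ℝ}, u < v → Real.sign (v - u) = 1 := fun h =>
    Real.sign_of_pos (sub_pos.2 h)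
  have neg : ∀ {u v : ℝ}, u < v → Real.sign (u - v) = -1 := fun h =>
    Real.sign_of_neg (sub_neg.2 h)
  rcases hxy.lt_or_gt with h | h <;> rcases hxz.lt_or_gt with h' | h' <;>
    rcases hyz.lt_or_gt with h'' | h'' <;>
    first
      | (exfalso; linarith)
      | norm_num [pos, neg, h, h', h'']

/-- A continuous function that almost surely separates two independent uniform angles. -/
structure IsHeight (H : ℝ → ℝ) : Prop where
  continuous : Continuous H
  turn_eq : ∀ s, turn {x | H x = H s} = 0

lemma IsHeight.measurable_incr (hH : IsHeight H) (k l : ι) : Measurable (incr H k l) :=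
  measurable_realSign.comp ((hH.continuous.measurable.comp (measurable_pi_apply l)).sub
    (hH.continuous.measurable.comp (measurable_pi_apply k)))

variable [Fintype ι]

lemma measurePreserving_comp_perm (π : Equiv.Perm ι) :
    MeasurePreserving (MeasurableEquiv.arrowCongr' π.symm (MeasurableEquiv.refl ℝ)) (turns ι)
      (turns ι) :=
  measurePreserving_arrowCongr' (fun _ => turn) (fun _ => turn) π.symm (MeasurableEquiv.refl ℝ)
    fun _ => MeasurePreserving.id turn

lemma integral_comp_perm (π : Equiv.Perm ι) (f : (ι → ℝ) → ℝ) :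
    ∫ a, f (a ∘ π) ∂turns ι = ∫ a, f a ∂turns ι :=
  (measurePreserving_comp_perm π).integral_comp' f

lemma integral_incr (H : ℝ → ℝ) (k l : ι) : ∫ a, incr H k l a ∂turns ι = 0 := by
  classical
  have hswap : ∀ a : ι → ℝ, incr H k l (a ∘ Equiv.swap k l) = -incr H k l a := fun a => by
    rw [← incr_swap]; simp [incr]
  have h := integral_comp_perm (Equiv.swap k l) (incr H k l)
  simp only [hswap, integral_neg] at h
  linarith

namespace IsHeight

lemma memLp_incr (hH : IsHeight H) (k l : ι) : MemLp (incr H k l) ⊤ (turns ι) :=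
  memLp_top_of_bound (hH.measurable_incr k l).aestronglyMeasurable 1
    (Eventually.of_forall fun a => abs_incr_le H k l a)

lemma integrable_incr (hH : IsHeight H) (k l : ι) : Integrable (incr H k l) (turns ι) :=
  (hH.memLp_incr k l).integrable le_top

lemma memLp_incr_mul_incr (hH : IsHeight H) (hH' : IsHeight H') (k l k' l' : ι) :
    MemLp (fun a => incr H k l a * incr H' k' l' a) ⊤ (turns ι) :=
  (hH'.memLp_incr k' l').mul' (hH.memLp_incr k l)

lemma integrable_incr_mul_incr (hH : IsHeight H) (hH' : IsHeight H') (k l k' l' : ι) :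
    Integrable (fun a => incr H k l a * incr H' k' l' a) (turns ι) :=
  (hH.memLp_incr_mul_incr hH' k l k' l').integrable le_top

lemma ae_ne (hH : IsHeight H) (hkl : k ≠ l) : ∀ᵐ a ∂turns ι, H (a k) ≠ H (a l) := by
  classical
  rw [ae_iff]
  simp only [not_not]
  refine le_antisymm (turns_le_of_slices ?_ l fun a => ?_) zero_le
  · exact measurableSet_eq_fun (hH.continuous.comp (continuous_apply k)).measurable
      (hH.continuous.comp (continuous_apply l)).measurable
  · simpa [Function.update_of_ne hkl, eq_comm] using (hH.turn_eq (a k)).le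

lemma ae_incr_sq (hH : IsHeight H) (hkl : k ≠ l) : ∀ᵐ a ∂turns ι, incr H k l a ^ 2 = 1 := by
  filter_upwards [hH.ae_ne hkl] with a ha using realSign_sq (sub_ne_zero.2 ha.symm)

/-- Of three distinct values the middle one is the only one from which the two increments have
opposite signs, so the three expectations with base points `k`, `l`, `m` add up to `1`; by symmetry
they are equal. -/
lemma integral_incr_mul_incr (hH : IsHeight H) (hkl : k ≠ l) (hkm : k ≠ m) (hlm : l ≠ m) :
    ∫ a, incr H k l a * incr H k m a ∂turns ι = 1 / 3 := by
  classical
  have hint := hH.integrable_incr_mul_incr hH (ι := ι)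
  have h₁ : ∫ a, incr H l k a * incr H l m a ∂turns ι =
      ∫ a, incr H k l a * incr H k m a ∂turns ι := by
    rw [← integral_comp_perm (Equiv.swap k l)]
    simp [incr, Equiv.swap_apply_of_ne_of_ne hkm.symm hlm.symm]
  have h₂ : ∫ a, incr H m k a * incr H m l a ∂turns ι =
      ∫ a, incr H k l a * incr H k m a ∂turns ι := by
    rw [← integral_comp_perm (Equiv.swap k m)]
    simp [incr, Equiv.swap_apply_of_ne_of_ne hkl.symm hlm, mul_comm]
  have hsum : ∫ a, (incr H k l a * incr H k m a + incr H l k a * incr H l m a +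
      incr H m k a * incr H m l a) ∂turns ι = 1 := by
    refine (integral_congr_ae (g := fun _ => (1 : ℝ)) ?_).trans (by simp)
    filter_upwards [hH.ae_ne hkl, hH.ae_ne hkm, hH.ae_ne hlm] with a using
      realSign_sub_mul_realSign_sub_add
  rw [integral_add (by exact (hint k l k m).add (hint l k l m)) (hint m k m l),
    integral_add (hint k l k m) (hint l k l m), h₁, h₂] at hsum
  linarith

end IsHeight

/-- Two heights whose increments from a fixed angle to a random one have signs whose product has an
expectation `τ` that does not depend on the fixed angle. -/
structure HasCorrelation (H H' : ℝ → ℝ) (τ : ℝ) : Prop where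
  left : IsHeight H
  right : IsHeight H'
  integral : ∀ s, ∫ x, Real.sign (H x - H s) * Real.sign (H' x - H' s) ∂turn = τ

namespace HasCorrelation

lemma integral_incr_mul_incr (h : HasCorrelation H H' τ) (hkl : k ≠ l) :
    ∫ a, incr H k l a * incr H' k l a ∂turns ι = τ := by
  classical
  rw [integral_turns_eq_integral_update l (h.left.integrable_incr_mul_incr h.right k l k l)]
  simp [incr, Function.update_of_ne hkl, h.integral]

lemma integral_incr_mul_incr_mul (h : HasCorrelation H H' τ) (hkl : k ≠ l) (hkm : k ≠ m)
    (hlm : l ≠ m) :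
    ∫ a, incr H k m a * incr H' k m a * (incr H l m a * incr H' l m a) ∂turns ι = τ ^ 2 := by
  classical
  have hint := ((h.left.memLp_incr_mul_incr h.right l m l m).mul'
    (h.left.memLp_incr_mul_incr h.right k m k m)).integrable (le_top (a := 1))
  have hinner : ∀ a : ι → ℝ, ∫ x, Real.sign (H (a m) - H x) * Real.sign (H' (a m) - H' x) ∂turn =
      τ := fun a => by
    rw [← h.integral (a m)]
    refine integral_congr_ae (Eventually.of_forall fun x => ?_)
    simp only [← neg_sub (H (a m)), ← neg_sub (H' (a m)), Real.sign_neg, neg_mul_neg]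
  rw [integral_turns_eq_integral_update k hint]
  simp only [incr, Function.update_self, Function.update_of_ne hkl.symm,
    Function.update_of_ne hkm.symm, integral_mul_const, hinner, integral_const_mul]
  rw [sq]
  exact congrArg (τ * ·) (h.integral_incr_mul_incr hlm)

end HasCorrelation

end Increments

/-! ### The number of choices of antipodes -/

lemma coe_pmSign (b : Bool) : ((pmSign b : SignType) : ℝ) = pmOne b := by
  cases b <;> simp [pmOne, pmSign]

lemma pmOne_sq (b : Bool) : pmOne b ^ 2 = 1 := by
  cases b <;> simp [pmOne]

lemma coe_signType_sq {s : SignType} (h : s ≠ 0) : (s : ℝ) ^ 2 = 1 := by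
  cases s <;> simp_all

lemma ite_sameSign_eq {a b c d : SignType} (ha : a ≠ 0) (hb : b ≠ 0) (hc : c ≠ 0) (hd : d ≠ 0) :
    (if SameSign a b c d then (1 : ℝ) else 0) =
      1 / 8 * (1 + a * b) * (1 + c * d) * (1 + a * c) := by
  cases a <;> cases b <;> cases c <;> cases d <;> simp_all [SameSign] <;> norm_num

/-- The indicator of the event that the `k`-th and the `l`-th edge cross, as a polynomial in the
signs `x`, `y` of the end points and the signs `D`, `E` of the determinants. -/
def pairWeight (x y : Fin 3 → ℝ) (D E : Fin 3 → Fin 3 → Fin 3 → ℝ) (k l : Fin 3) : ℝ :=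
  1 / 8 * (1 + x k * x l * (E k l k * E k l l)) * (1 + y k * y l * (D k l k * D k l l)) *
    (1 + x l * y l * (D k l k * E k l k))

lemma ite_pairCross_eq (ε η : Fin 3 → Bool) {D E : Fin 3 → Fin 3 → Fin 3 → SignType}
    {k l : Fin 3} (hD : ∀ m, D k l m ≠ 0) (hE : ∀ m, E k l m ≠ 0) :
    (if PairCross ε η D E k l then (1 : ℝ) else 0) =
      pairWeight (pmOne ∘ ε) (pmOne ∘ η) (fun k l m => D k l m) (fun k l m => E k l m) k l := by
  have ne : ∀ b, pmSign b ≠ 0 := by decide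
  have h := ite_sameSign_eq (a := pmSign (ε k) * pmSign (ε l) * pmSign (η k) * D k l k)
    (b := pmSign (ε k) * pmSign (ε l) * pmSign (η l) * D k l l)
    (c := pmSign (η k) * pmSign (η l) * pmSign (ε k) * E k l k)
    (d := pmSign (η k) * pmSign (η l) * pmSign (ε l) * E k l l)
    (by simp [ne, hD]) (by simp [ne, hD]) (by simp [ne, hE]) (by simp [ne, hE])
  simp only [SignType.coe_mul, coe_pmSign] at h
  refine h.trans ?_
  rw [pairWeight, Function.comp_apply, Function.comp_apply, Function.comp_apply,
    Function.comp_apply]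
  cases ε k <;> cases ε l <;> cases η k <;> cases η l <;>
    simp only [pmOne, Bool.false_eq_true, if_true, if_false] <;> ring

/-- The number of choices of signs for which three edges cross pairwise, given the signs of their
determinants. Each crossing prescribes three products of two of the six unknown signs. Any five
independent ones of these nine equations have two solutions, and the four factors say that these
satisfy the other four. -/
def crossCount (D E : Fin 3 → Fin 3 → Fin 3 → ℝ) : ℝ :=
  1 / 8 * (1 + D 0 1 0 * D 0 1 1 * (D 0 2 0 * D 0 2 2) * (D 1 2 1 * D 1 2 2)) *
    (1 + E 0 1 0 * E 0 1 1 * (E 0 2 0 * E 0 2 2) * (E 1 2 1 * E 1 2 2)) *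
    (1 + D 0 2 0 * E 0 2 0 * (D 1 2 1 * E 1 2 1)) *
    (1 + D 0 1 0 * E 0 1 0 * (D 1 2 1 * E 1 2 1) * (D 1 2 1 * D 1 2 2) * (E 1 2 1 * E 1 2 2))

/-- The indicator of five independent ones among the nine equations for the signs `x` and `y`. -/
def treeWeight (x y : Fin 3 → ℝ) (D E : Fin 3 → Fin 3 → Fin 3 → ℝ) : ℝ :=
  1 / 32 * ((1 + x 0 * x 1 * (E 0 1 0 * E 0 1 1)) * (1 + x 1 * x 2 * (E 1 2 1 * E 1 2 2)) *
    (1 + y 0 * y 1 * (D 0 1 0 * D 0 1 1)) * (1 + y 1 * y 2 * (D 1 2 1 * D 1 2 2)) *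
    (1 + x 2 * y 2 * (D 1 2 1 * E 1 2 1)))

lemma prod_one_add_eq {p q r : Fin 3 → Fin 3 → ℝ} (hp₀ : p 0 1 ^ 2 = 1) (hp₁ : p 1 2 ^ 2 = 1)
    (hq₀ : q 0 1 ^ 2 = 1) (hq₁ : q 1 2 ^ 2 = 1) (hr : r 1 2 ^ 2 = 1) :
    (1 + p 0 1) * (1 + q 0 1) * (1 + r 0 1) * ((1 + p 0 2) * (1 + q 0 2) * (1 + r 0 2)) *
        ((1 + p 1 2) * (1 + q 1 2) * (1 + r 1 2)) =
      (1 + q 0 1 * q 0 2 * q 1 2) * (1 + p 0 1 * p 0 2 * p 1 2) * (1 + r 0 2 * r 1 2) *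
        (1 + r 0 1 * r 1 2 * q 1 2 * p 1 2) *
        ((1 + p 0 1) * (1 + p 1 2) * (1 + q 0 1) * (1 + q 1 2) * (1 + r 1 2)) := by
  rcases sq_eq_one_iff.1 hp₀ with h₀ | h₀
  · rcases sq_eq_one_iff.1 hp₁ with h₁ | h₁
    · rcases sq_eq_one_iff.1 hq₀ with h₂ | h₂
      · rcases sq_eq_one_iff.1 hq₁ with h₃ | h₃
        · rcases sq_eq_one_iff.1 hr with h₄ | h₄
          · rw [h₀, h₁, h₂, h₃, h₄]; ring
          · simp [h₄]
        · simp [h₃]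
      · simp [h₂]
    · simp [h₁]
  · simp [h₀]

lemma prod_pairWeight_eq {x y : Fin 3 → ℝ} {D E : Fin 3 → Fin 3 → Fin 3 → ℝ}
    (hx : ∀ k, x k ^ 2 = 1) (hy : ∀ k, y k ^ 2 = 1) (hD : ∀ k l m, k ≠ l → D k l m ^ 2 = 1)
    (hE : ∀ k l m, k ≠ l → E k l m ^ 2 = 1) :
    pairWeight x y D E 0 1 * pairWeight x y D E 0 2 * pairWeight x y D E 1 2 =
      1 / 2 * crossCount D E * treeWeight x y D E := by
  have h := prod_one_add_eq (p := fun k l => x k * x l * (E k l k * E k l l))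
    (q := fun k l => y k * y l * (D k l k * D k l l))
    (r := fun k l => x l * y l * (D k l k * E k l k))
    (by simp [mul_pow, hx, hE]) (by simp [mul_pow, hx, hE]) (by simp [mul_pow, hy, hD])
    (by simp [mul_pow, hy, hD]) (by simp [mul_pow, hx, hy, hD, hE])
  have cancel : ∀ {a b c s : ℝ}, a ^ 2 = 1 → b ^ 2 = 1 → c ^ 2 = 1 →
      a ^ 2 * b ^ 2 * c ^ 2 * s = s := fun ha hb hc => by rw [ha, hb, hc]; ring
  have hq : ∀ {s₀ s₁ s₂ : ℝ}, y 0 * y 1 * s₀ * (y 0 * y 2 * s₁) * (y 1 * y 2 * s₂) =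
      s₀ * s₁ * s₂ := fun {s₀ s₁ s₂} => by
    linear_combination cancel (hy 0) (hy 1) (hy 2) (s := s₀ * s₁ * s₂)
  have hp : ∀ {s₀ s₁ s₂ : ℝ}, x 0 * x 1 * s₀ * (x 0 * x 2 * s₁) * (x 1 * x 2 * s₂) =
      s₀ * s₁ * s₂ := fun {s₀ s₁ s₂} => by
    linear_combination cancel (hx 0) (hx 1) (hx 2) (s := s₀ * s₁ * s₂)
  have hr : ∀ {s₀ s₁ : ℝ}, x 2 * y 2 * s₀ * (x 2 * y 2 * s₁) = s₀ * s₁ := fun {s₀ s₁} => by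
    linear_combination cancel (hx 2) (hy 2) (one_pow 2) (s := s₀ * s₁)
  have hrpq : ∀ {s₀ s₁ s₂ s₃ : ℝ}, x 1 * y 1 * s₀ * (x 2 * y 2 * s₁) * (y 1 * y 2 * s₂) *
      (x 1 * x 2 * s₃) = s₀ * s₁ * s₂ * s₃ := fun {s₀ s₁ s₂ s₃} => by
    linear_combination cancel (hx 1) (hx 2) (hy 1) (s := s₀ * s₁ * s₂ * s₃ * y 2 ^ 2) +
      s₀ * s₁ * s₂ * s₃ * hy 2
  simp only [hp, hq, hr, hrpq] at h
  simp only [pairWeight, crossCount, treeWeight]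
  linear_combination 1 / 512 * h

/-- Triples of elements as functions. -/
def tripleEquiv (α : Type*) : (Fin 3 → α) ≃ α × α × α where
  toFun f := (f 0, f 1, f 2)
  invFun x := ![x.1, x.2.1, x.2.2]
  left_inv f := by ext k; fin_cases k <;> rfl
  right_inv _ := rfl

lemma sum_triples {α M : Type*} [Fintype α] [AddCommMonoid M] (f : (Fin 3 → α) → M) :
    ∑ x, f x = ∑ x, ∑ y, ∑ z, f ![x, y, z] := by
  rw [← (tripleEquiv α).symm.sum_comp]
  simp only [Fintype.sum_prod_type]
  rfl

lemma sum_treeWeight (D E : Fin 3 → Fin 3 → Fin 3 → ℝ) :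
    ∑ ε : Fin 3 → Bool, ∑ η : Fin 3 → Bool, treeWeight (pmOne ∘ ε) (pmOne ∘ η) D E = 2 := by
  simp only [treeWeight, ← Finset.mul_sum, Function.comp_apply, sum_triples, Fintype.sum_bool,
    pmOne, Matrix.cons_val, Bool.false_eq_true, if_true, if_false]
  ring

lemma sum_allCross {D E : Fin 3 → Fin 3 → Fin 3 → SignType}
    (hD : ∀ k l m, k ≠ l → D k l m ≠ 0) (hE : ∀ k l m, k ≠ l → E k l m ≠ 0) :
    ∑ ε, ∑ η, (if AllCross ε η D E then (1 : ℝ) else 0) =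
      crossCount (fun k l m => D k l m) (fun k l m => E k l m) := by
  have hind : ∀ ε η, (if AllCross ε η D E then (1 : ℝ) else 0) =
      1 / 2 * crossCount (fun k l m => D k l m) (fun k l m => E k l m) *
        treeWeight (pmOne ∘ ε) (pmOne ∘ η) (fun k l m => D k l m) (fun k l m => E k l m) :=
    fun ε η => by
    have hall : AllCross ε η D E ↔
        (PairCross ε η D E 0 1 ∧ PairCross ε η D E 0 2) ∧ PairCross ε η D E 1 2 := by
      simp [AllCross, Fin.forall_fin_succ]
    have hpair {k l : Fin 3} (h : k ≠ l) :=
      ite_pairCross_eq ε η (fun m => hD k l m h) (fun m => hE k l m h)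
    rw [← prod_pairWeight_eq (x := pmOne ∘ ε) (y := pmOne ∘ η) (fun k => pmOne_sq (ε k))
      (fun k => pmOne_sq (η k)) (fun k l m h => coe_signType_sq (hD k l m h))
      (fun k l m h => coe_signType_sq (hE k l m h)),
      ← hpair (by decide), ← hpair (by decide), ← hpair (by decide)]
    simp only [ite_zero_mul_ite_zero, hall, mul_one]
  simp only [hind, ← Finset.mul_sum, sum_treeWeight]
  ring

/-! ### Symmetries of the limiting density -/

section Symmetries

variable {ι κ σ : Type*} [DecidableEq ι]

lemma side_swap (X : ι → Frame) (Y : κ → Frame) (r : ℝ) (i : ι) (s : ℝ) (i' : ι) (s' : ℝ) (j : κ)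
    (t : ℝ) : side X Y r i' s' i s j t = -side X Y r i s i' s' j t := by
  by_cases h : i = i'
  · subst h
    rw [side, side, if_pos rfl, if_pos rfl, (X i).pt_eq_add r s s', ← neg_sub ((X i).dir s'),
      det3_add_left, det3_smul_left, ← neg_one_smul ℝ, det3_smul_mid, det3_smul_mid,
      det3_self_left]
    ring
  · rw [side, side, if_neg h, if_neg (Ne.symm h), det3_swap_left]

lemma sideSigns_swap (X : ι → Frame) (Y : κ → Frame) (r : ℝ) (I : σ → ι) (J : σ → κ)
    (a b : σ → ℝ) (k l m : σ) : sideSigns X Y r I J a b l k m = -sideSigns X Y r I J a b k l m := by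
  rw [sideSigns, side_swap, Left.sign_neg, sideSigns]

lemma sameSign_rotate {a b c d : SignType} : SameSign c d a b ↔ SameSign a b c d := by
  revert a b c d; decide

lemma SameSign.neg_swap {a b c d : SignType} :
    SameSign a b c d → SameSign (-b) (-a) (-d) (-c) := by
  revert a b c d; decide

lemma PairCross.symm {ε η : σ → Bool} {D E : σ → σ → σ → SignType}
    (hD : ∀ k l m, D l k m = -D k l m) (hE : ∀ k l m, E l k m = -E k l m) {k l : σ}
    (h : PairCross ε η D E k l) : PairCross ε η D E l k := by
  rw [PairCross, hD k l, hD k l, hE k l, hE k l]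
  convert h.neg_swap using 1 <;> rw [mul_neg, neg_inj] <;> congr 2 <;> exact mul_comm _ _

lemma allCross_iff_ne {ε η : Fin 3 → Bool} {D E : Fin 3 → Fin 3 → Fin 3 → SignType}
    (hD : ∀ k l m, D l k m = -D k l m) (hE : ∀ k l m, E l k m = -E k l m) :
    AllCross ε η D E ↔ ∀ k l, k ≠ l → PairCross ε η D E k l :=
  ⟨fun h k l hkl => hkl.lt_or_gt.elim (h k l) fun h' => (h l k h').symm hD hE,
    fun h k l hkl => h k l hkl.ne⟩

variable [DecidableEq κ]

lemma crossWeight_comp_perm (X : ι → Frame) (Y : κ → Frame) (I : Fin 3 → ι) (J : Fin 3 → κ)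
    (ε η : Fin 3 → Bool) (r : ℝ) (π : Equiv.Perm (Fin 3)) (a b : Fin 3 → ℝ) :
    crossWeight X Y (I ∘ π) (J ∘ π) (ε ∘ π) (η ∘ π) r (a ∘ π) (b ∘ π) =
      crossWeight X Y I J ε η r a b := by
  refine if_congr ?_ rfl rfl
  rw [allCross_iff_ne (sideSigns_swap X Y r (I ∘ π) (J ∘ π) (a ∘ π) (b ∘ π))
      (sideSigns_swap Y X r (J ∘ π) (I ∘ π) (b ∘ π) (a ∘ π)),
    allCross_iff_ne (sideSigns_swap X Y r I J a b) (sideSigns_swap Y X r J I b a)]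
  constructor
  · intro h k l hkl
    have := h (π.symm k) (π.symm l) (π.symm.injective.ne hkl)
    simpa [PairCross, sideSigns] using this
  · exact fun h k l hkl => h (π k) (π l) (π.injective.ne hkl)

lemma crossWeight_swap (X : ι → Frame) (Y : κ → Frame) (I : Fin 3 → ι) (J : Fin 3 → κ)
    (ε η : Fin 3 → Bool) (r : ℝ) (a b : Fin 3 → ℝ) :
    crossWeight Y X J I η ε r b a = crossWeight X Y I J ε η r a b :=
  if_congr (forall₂_congr fun _ _ => imp_congr_right fun _ => sameSign_rotate) rfl rfl

/-- The expected number of choices of antipodes for which three random edges, between the nodes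
`I k` and `J k` up to antipodes, cross pairwise, in the limit of radius zero. -/
def signExpectation (X : ι → Frame) (Y : κ → Frame) (I : Fin 3 → ι) (J : Fin 3 → κ) : ℝ :=
  ∫ ω, ∑ ε, ∑ η, crossWeight X Y I J ε η 0 ω.1 ω.2 ∂params

lemma signExpectation_comp_perm (X : ι → Frame) (Y : κ → Frame) (I : Fin 3 → ι) (J : Fin 3 → κ)
    (π : Equiv.Perm (Fin 3)) :
    signExpectation X Y (I ∘ π) (J ∘ π) = signExpectation X Y I J := by
  have h := ((measurePreserving_comp_perm π).prod (measurePreserving_comp_perm π)).integral_comp'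
    (f := MeasurableEquiv.prodCongr _ _)
    fun ω : Params => ∑ ε, ∑ η, crossWeight X Y (I ∘ π) (J ∘ π) ε η 0 ω.1 ω.2
  rw [signExpectation, params, ← h, signExpectation]
  refine integral_congr_ae (Eventually.of_forall fun ω => ?_)
  beta_reduce
  rw [← (π.arrowCongr (Equiv.refl Bool)).symm.sum_comp]
  refine Finset.sum_congr rfl fun ε _ => ?_
  rw [← (π.arrowCongr (Equiv.refl Bool)).symm.sum_comp]
  exact Finset.sum_congr rfl fun η _ => crossWeight_comp_perm X Y I J ε η 0 π ω.1 ω.2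

lemma signExpectation_swap (X : ι → Frame) (Y : κ → Frame) (I : Fin 3 → ι) (J : Fin 3 → κ) :
    signExpectation Y X J I = signExpectation X Y I J := by
  rw [signExpectation, ← measurePreserving_swap_params.integral_comp'
    (f := MeasurableEquiv.prodComm), signExpectation]
  refine integral_congr_ae (Eventually.of_forall fun ω => Finset.sum_comm.trans ?_)
  exact Finset.sum_congr rfl fun ε _ => Finset.sum_congr rfl fun η _ =>
    crossWeight_swap X Y I J ε η 0 ω.1 ω.2

end Symmetries

lemma limitDensity_zero (X Y : Fin 2 → Frame) :
    limitDensity X Y 0 = 1 / 2 ^ 12 * ∑ I, ∑ J, signExpectation X Y I J := by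
  rw [limitDensity]
  refine congrArg _ (Finset.sum_congr rfl fun I _ => Finset.sum_congr rfl fun J _ => ?_)
  rw [signExpectation, integral_finsetSum _ fun ε _ => integrable_finsetSum _ fun η _ =>
    integrable_crossWeight X Y I J ε η 0]
  refine Finset.sum_congr rfl fun ε _ => ?_
  rw [integral_finsetSum _ fun η _ => integrable_crossWeight X Y I J ε η 0]

/-! ### The signs at radius zero -/

section LimitSigns

variable {ι κ : Type*}

/-- The determinant of the centre of `F`, a tangent direction at it and `p`, as a function of the
angle of the direction. -/
def height (F : Frame) (p : E3) (s : ℝ) : ℝ := det3 F.c (F.dir s) p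

/-- The sign of the determinant of three centres. -/
def centreSign (X : ι → Frame) (Y : κ → Frame) (i i' : ι) (j : κ) : ℝ :=
  Real.sign (det3 (X i).c (X i').c (Y j).c)

variable [DecidableEq ι]

/-- The signs `sideSigns` at radius zero, as real numbers. -/
def limitSign (X : ι → Frame) (Y : κ → Frame) (I : Fin 3 → ι) (J : Fin 3 → κ) (a : Fin 3 → ℝ)
    (k l m : Fin 3) : ℝ :=
  if I k = I l then incr (height (X (I k)) (Y (J m)).c) k l a
  else centreSign X Y (I k) (I l) (J m)

lemma coe_sideSigns_zero (X : ι → Frame) (Y : κ → Frame) (I : Fin 3 → ι) (J : Fin 3 → κ)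
    (a b : Fin 3 → ℝ) (k l m : Fin 3) :
    ((sideSigns X Y 0 I J a b k l m : SignType) : ℝ) = limitSign X Y I J a k l m := by
  rw [sideSigns, coe_sign_eq_realSign, side, limitSign]
  split_ifs with h
  · rw [Frame.pt_zero, Frame.pt_zero, det3_sub_mid, incr, height, height]
  · rw [Frame.pt_zero, Frame.pt_zero, Frame.pt_zero, centreSign]

lemma signExpectation_eq [DecidableEq κ] {X : ι → Frame} {Y : κ → Frame} {m : ℝ}
    (hX : Nondegenerate X Y m) (hY : Nondegenerate Y X m) (I : Fin 3 → ι) (J : Fin 3 → κ) :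
    signExpectation X Y I J =
      ∫ ω, crossCount (limitSign X Y I J ω.1) (limitSign Y X J I ω.2) ∂params := by
  have h1 : 3 * (0 : ℝ) < m := by simpa using hX.pos
  refine integral_congr_ae ?_
  filter_upwards [hX.ae_side_ne_zero le_rfl h1 I J,
    measurePreserving_swap_params.quasiMeasurePreserving.ae (hY.ae_side_ne_zero le_rfl h1 J I)]
    with ω hω hω'
  have h := sum_allCross (D := sideSigns X Y 0 I J ω.1 ω.2) (E := sideSigns Y X 0 J I ω.2 ω.1)
    (fun k l n hkl => sign_ne_zero.2 (hω k l n hkl))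
    (fun k l n hkl => sign_ne_zero.2 (hω' k l n hkl))
  simp only [coe_sideSigns_zero] at h
  exact h

end LimitSigns

/-! ### The expected number of choices, by the pattern of nodes -/

/-- The data of an antipodal drawing that determine the limit of the triangle densities. -/
structure LimitData {ι κ : Type*} (X : ι → Frame) (Y : κ → Frame) (m : ℝ) (τ : ι → ℝ)
    (σ : κ → ℝ) : Prop where
  left : Nondegenerate X Y m
  right : Nondegenerate Y X m
  corr_left : ∀ i j j', j ≠ j' →
    HasCorrelation (height (X i) (Y j).c) (height (X i) (Y j').c) (τ i)
  corr_right : ∀ j i i', i ≠ i' →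
    HasCorrelation (height (Y j) (X i).c) (height (Y j) (X i').c) (σ j)
  centre_left : ∀ i i' j j', centreSign X Y i i' j = centreSign X Y i i' j'
  centre_right : ∀ j j' i i', centreSign Y X j j' i = centreSign Y X j j' i'

section Patterns

variable {ι κ : Type*} {X : ι → Frame} {Y : κ → Frame} {m : ℝ} {τ : ι → ℝ} {σ : κ → ℝ}
  {H K : ℝ → ℝ}

lemma LimitData.symm (h : LimitData X Y m τ σ) : LimitData Y X m σ τ :=
  ⟨h.right, h.left, h.corr_right, h.corr_left, h.centre_right, h.centre_left⟩

lemma LimitData.isHeight [Nontrivial κ] (h : LimitData X Y m τ σ) (i : ι) (j : κ) :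
    IsHeight (height (X i) (Y j).c) :=
  have ⟨j', hj⟩ := exists_ne j
  (h.corr_left i j j' hj.symm).left

lemma LimitData.centreSign_sq (h : LimitData X Y m τ σ) {i i' : ι} (hi : i ≠ i') (j : κ) :
    centreSign X Y i i' j ^ 2 = 1 :=
  realSign_sq (abs_pos.1 (h.left.pos.trans_le (h.left.le_det3 i i' j hi)))

lemma IsHeight.ae_incr_fst_sq (hH : IsHeight H) {k l : Fin 3} (hkl : k ≠ l) :
    ∀ᵐ ω ∂params, incr H k l ω.1 ^ 2 = 1 :=
  Measure.quasiMeasurePreserving_fst.ae (hH.ae_incr_sq hkl)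

lemma IsHeight.ae_incr_snd_sq (hK : IsHeight K) {k l : Fin 3} (hkl : k ≠ l) :
    ∀ᵐ ω ∂params, incr K k l ω.2 ^ 2 = 1 :=
  Measure.quasiMeasurePreserving_snd.ae (hK.ae_incr_sq hkl)

lemma integral_params_add {f f' g g' : (Fin 3 → ℝ) → ℝ} (hf : Integrable f (turns (Fin 3)))
    (hf' : Integrable f' (turns (Fin 3))) (hg : Integrable g (turns (Fin 3)))
    (hg' : Integrable g' (turns (Fin 3))) :
    ∫ ω, (f ω.1 * g ω.2 + f' ω.1 * g' ω.2) ∂params =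
      (∫ a, f a ∂turns (Fin 3)) * (∫ b, g b ∂turns (Fin 3)) +
        (∫ a, f' a ∂turns (Fin 3)) * (∫ b, g' b ∂turns (Fin 3)) := by
  rw [integral_add (hf.mul_prod hg) (hf'.mul_prod hg'), integral_prod_mul, integral_prod_mul]

lemma integral_params_add_mul_incr (hK : IsHeight K) {f g : (Fin 3 → ℝ) → ℝ}
    (hf : Integrable f (turns (Fin 3))) (hg : Integrable g (turns (Fin 3))) (k l : Fin 3) :
    ∫ ω, (f ω.1 + g ω.1 * incr K k l ω.2) ∂params = ∫ a, f a ∂turns (Fin 3) := by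
  have h := integral_params_add hf hg (integrable_const (1 : ℝ)) (hK.integrable_incr k l)
  simpa [integral_incr] using h

/-- The product of the signs of the increments of `H` and `K` from the `k`-th edge to the two other
ones. -/
def cornerSign (H K : ℝ → ℝ) (k l m : Fin 3) (ω : Params) : ℝ :=
  incr H k l ω.1 * incr H k m ω.1 * (incr K k l ω.2 * incr K k m ω.2)

lemma integrable_cornerSign (hH : IsHeight H) (hK : IsHeight K) (k l m : Fin 3) :
    Integrable (cornerSign H K k l m) params :=
  (hH.integrable_incr_mul_incr hH k l k m).mul_prod (hK.integrable_incr_mul_incr hK k l k m)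

lemma integral_cornerSign (hH : IsHeight H) (hK : IsHeight K) {k l m : Fin 3} (hkl : k ≠ l)
    (hkm : k ≠ m) (hlm : l ≠ m) : ∫ ω, cornerSign H K k l m ω ∂params = 1 / 9 := by
  have h := integral_prod_mul (μ := turns (Fin 3)) (ν := turns (Fin 3))
    (fun a => incr H k l a * incr H k m a) (fun b => incr K k l b * incr K k m b)
  rw [hH.integral_incr_mul_incr hkl hkm hlm, hK.integral_incr_mul_incr hkl hkm hlm] at h
  exact h.trans (by norm_num)

variable [DecidableEq ι] [DecidableEq κ]

lemma ae_crossCount_same_same [Nontrivial ι] [Nontrivial κ] (h : LimitData X Y m τ σ) (i : ι)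
    (j : κ) :
    ∀ᵐ ω ∂params,
      crossCount (limitSign X Y ![i, i, i] ![j, j, j] ω.1)
        (limitSign Y X ![j, j, j] ![i, i, i] ω.2) =
      1 / 2 * (1 + cornerSign (height (X i) (Y j).c) (height (Y j) (X i).c) 0 1 2 ω +
        cornerSign (height (X i) (Y j).c) (height (Y j) (X i).c) 1 0 2 ω +
        cornerSign (height (X i) (Y j).c) (height (Y j) (X i).c) 2 0 1 ω) := by
  have hH := h.isHeight i j
  have hK := h.symm.isHeight j i
  filter_upwards [hH.ae_incr_fst_sq (show (0 : Fin 3) ≠ 1 by decide),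
    hH.ae_incr_fst_sq (show (0 : Fin 3) ≠ 2 by decide),
    hH.ae_incr_fst_sq (show (1 : Fin 3) ≠ 2 by decide),
    hK.ae_incr_snd_sq (show (0 : Fin 3) ≠ 1 by decide),
    hK.ae_incr_snd_sq (show (0 : Fin 3) ≠ 2 by decide),
    hK.ae_incr_snd_sq (show (1 : Fin 3) ≠ 2 by decide)] with ω hx hy hz hx' hy' hz'
  simp only [crossCount, limitSign, cornerSign, Matrix.cons_val, if_true,
    incr_swap _ (0 : Fin 3) 1, incr_swap _ (0 : Fin 3) 2, incr_swap _ (1 : Fin 3) 2]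
  grind

lemma signExpectation_same_same [Nontrivial ι] [Nontrivial κ] (h : LimitData X Y m τ σ) (i : ι)
    (j : κ) : signExpectation X Y ![i, i, i] ![j, j, j] = 2 / 3 := by
  have hH := h.isHeight i j
  have hK := h.symm.isHeight j i
  have hint := integrable_cornerSign hH hK
  rw [signExpectation_eq h.left h.right, integral_congr_ae (ae_crossCount_same_same h i j),
    integral_const_mul, integral_add (by fun_prop) (hint 2 0 1),
    integral_add (by fun_prop) (hint 1 0 2), integral_add (integrable_const 1) (hint 0 1 2),
    integral_cornerSign hH hK (by decide) (by decide) (by decide),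
    integral_cornerSign hH hK (by decide) (by decide) (by decide),
    integral_cornerSign hH hK (by decide) (by decide) (by decide)]
  norm_num

/-- The factor of `crossCount` that carries its expectation if all three edges start at one node and
two of them end at another one. -/
def splitWeight (H H' : ℝ → ℝ) (a : Fin 3 → ℝ) : ℝ :=
  1 / 4 * (1 + incr H 0 2 a * incr H 1 2 a + incr H' 0 2 a * incr H' 1 2 a +
    incr H 0 2 a * incr H' 0 2 a * (incr H 1 2 a * incr H' 1 2 a))

lemma IsHeight.memLp_splitWeight {H' : ℝ → ℝ} (hH : IsHeight H) (hH' : IsHeight H') :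
    MemLp (splitWeight H H') ⊤ (turns (Fin 3)) := by
  have hmul : MemLp (fun a => incr H 0 2 a * incr H' 0 2 a * (incr H 1 2 a * incr H' 1 2 a)) ⊤
      (turns (Fin 3)) :=
    (hH.memLp_incr_mul_incr hH' 1 2 1 2).mul' (hH.memLp_incr_mul_incr hH' 0 2 0 2)
  unfold splitWeight
  refine MemLp.const_mul ?_ (1 / 4)
  refine MemLp.add ?_ hmul
  refine MemLp.add ?_ (hH'.memLp_incr_mul_incr hH' 0 2 1 2)
  exact (memLp_const (1 : ℝ)).add (hH.memLp_incr_mul_incr hH 0 2 1 2)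

lemma HasCorrelation.integral_splitWeight {H' : ℝ → ℝ} {τ : ℝ} (h : HasCorrelation H H' τ) :
    ∫ a, splitWeight H H' a ∂turns (Fin 3) = 1 / 4 * (5 / 3 + τ ^ 2) := by
  have hflip : ∀ {H : ℝ → ℝ}, IsHeight H →
      ∫ a, incr H 0 2 a * incr H 1 2 a ∂turns (Fin 3) = 1 / 3 := fun {H} hH => by
    rw [← hH.integral_incr_mul_incr (show (2 : Fin 3) ≠ 0 by decide)
      (show (2 : Fin 3) ≠ 1 by decide) (show (0 : Fin 3) ≠ 1 by decide)]
    simp only [incr_swap H (0 : Fin 3) 2, incr_swap H (1 : Fin 3) 2, neg_mul_neg]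
  have hint := h.left.integrable_incr_mul_incr h.left (0 : Fin 3) 2 1 2
  have hint' := h.right.integrable_incr_mul_incr h.right (0 : Fin 3) 2 1 2
  have hint'' := ((h.left.memLp_incr_mul_incr h.right (1 : Fin 3) 2 1 2).mul'
      (h.left.memLp_incr_mul_incr h.right 0 2 0 2)).integrable (le_top (a := 1))
  simp only [splitWeight]
  rw [integral_const_mul, integral_add (by fun_prop) hint'', integral_add (by fun_prop) hint',
    integral_add (integrable_const 1) hint, hflip h.left, hflip h.right,
    h.integral_incr_mul_incr_mul (by decide) (by decide) (by decide)]
  simp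
  ring

lemma signExpectation_same_split [Nontrivial ι] (h : LimitData X Y m τ σ) (i : ι) {j j' : κ}
    (hj : j ≠ j') : signExpectation X Y ![i, i, i] ![j, j, j'] = 1 / 4 * (5 / 3 + τ i ^ 2) := by
  have hc := h.corr_left i j j' hj
  have hs := h.symm.centreSign_sq hj i
  have hK := h.symm.isHeight j i
  have hf := hc.left.memLp_splitWeight hc.right
  have hg := hf.mul' ((hc.left.memLp_incr_mul_incr hc.right 0 1 1 2).const_mul
    (centreSign Y X j j' i)) (r := ⊤)
  rw [signExpectation_eq h.left h.right, ← hc.integral_splitWeight,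
    ← integral_params_add_mul_incr hK (hf.integrable le_top) (hg.integrable le_top) 0 1]
  refine integral_congr_ae ?_
  filter_upwards [hc.left.ae_incr_fst_sq (show (0 : Fin 3) ≠ 1 by decide),
    hc.left.ae_incr_fst_sq (show (0 : Fin 3) ≠ 2 by decide),
    hc.left.ae_incr_fst_sq (show (1 : Fin 3) ≠ 2 by decide),
    hK.ae_incr_snd_sq (show (0 : Fin 3) ≠ 1 by decide)] with ω hx hy hz hk
  simp only [crossCount, limitSign, splitWeight, Matrix.cons_val, if_true, hj, if_false]
  grind

lemma signExpectation_split_split [Nontrivial ι] [Nontrivial κ] (h : LimitData X Y m τ σ)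
    {i i' : ι} {j j' : κ} (hi : i ≠ i') (hj : j ≠ j') :
    signExpectation X Y ![i, i, i'] ![j, j, j'] = 1 := by
  have hH := h.isHeight i j
  have hK := h.symm.isHeight j i
  have hs := h.centreSign_sq hi j
  have ht := h.symm.centreSign_sq hj i
  have hint := integral_params_add_mul_incr hK (integrable_const 1)
    ((hH.integrable_incr 0 1).const_mul (centreSign X Y i i' j * centreSign Y X j j' i)) 0 1
  rw [integral_const, probReal_univ, one_smul] at hint
  rw [signExpectation_eq h.left h.right, ← hint]
  refine integral_congr_ae ?_
  filter_upwards [hH.ae_incr_fst_sq (show (0 : Fin 3) ≠ 1 by decide),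
    hK.ae_incr_snd_sq (show (0 : Fin 3) ≠ 1 by decide)] with ω hx hk
  simp only [crossCount, limitSign, Matrix.cons_val, if_true, hi, hj, if_false,
    h.centre_left i i' j' j, h.centre_right j j' i' i]
  grind

section HasCorrelation

variable {H' K' : ℝ → ℝ} {μ ν : ℝ}

lemma HasCorrelation.integrable_one_add_incr_mul_incr (h : HasCorrelation H H' μ) (k l : Fin 3) :
    Integrable (fun a => 1 + incr H k l a * incr H' k l a) (turns (Fin 3)) :=
  (integrable_const (1 : ℝ)).add (h.left.integrable_incr_mul_incr h.right k l k l)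

lemma HasCorrelation.integral_one_add_incr_mul_incr (h : HasCorrelation H H' μ) {k l : Fin 3}
    (hkl : k ≠ l) : ∫ a, (1 + incr H k l a * incr H' k l a) ∂turns (Fin 3) = 1 + μ := by
  rw [integral_add (integrable_const 1) (h.left.integrable_incr_mul_incr h.right k l k l),
    h.integral_incr_mul_incr hkl]
  simp

lemma HasCorrelation.integrable_incr_add_incr (h : HasCorrelation H H' μ) (k l : Fin 3) :
    Integrable (fun a => incr H k l a + incr H' k l a) (turns (Fin 3)) :=
  (h.left.integrable_incr k l).add (h.right.integrable_incr k l)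

lemma HasCorrelation.integral_incr_add_incr (h : HasCorrelation H H' μ) (k l : Fin 3) :
    ∫ a, (incr H k l a + incr H' k l a) ∂turns (Fin 3) = 0 := by
  rw [integral_add (h.left.integrable_incr k l) (h.right.integrable_incr k l), integral_incr,
    integral_incr, add_zero]

lemma HasCorrelation.integral_path (h : HasCorrelation H H' μ) (h' : HasCorrelation K K' ν)
    {k l k' l' : Fin 3} (hkl : k ≠ l) (hkl' : k' ≠ l') (s t : ℝ) :
    ∫ ω, ((1 + incr H k l ω.1 * incr H' k l ω.1) *
          (1 + incr K k' l' ω.2 * incr K' k' l' ω.2 + t * (incr K k' l' ω.2 + incr K' k' l' ω.2)) +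
        (incr H k l ω.1 + incr H' k l ω.1) * (s * (incr K k' l' ω.2 + incr K' k' l' ω.2 +
          t * (1 + incr K k' l' ω.2 * incr K' k' l' ω.2)))) ∂params = (1 + μ) * (1 + ν) := by
  have hg := h'.integrable_one_add_incr_mul_incr k' l'
  have hg' := h'.integrable_incr_add_incr k' l'
  have hint := integral_params_add (h.integrable_one_add_incr_mul_incr k l)
    (h.integrable_incr_add_incr k l) (hg.add (hg'.const_mul t))
    ((hg'.add (hg.const_mul t)).const_mul s)
  simp only [Pi.add_apply] at hint
  rw [hint, h.integral_one_add_incr_mul_incr hkl, h.integral_incr_add_incr, zero_mul, add_zero,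
    integral_add hg (hg'.const_mul t), h'.integral_one_add_incr_mul_incr hkl', integral_const_mul,
    h'.integral_incr_add_incr, mul_zero, add_zero]

end HasCorrelation

lemma signExpectation_path (h : LimitData X Y m τ σ) {i i' : ι} {j j' : κ} (hi : i ≠ i')
    (hj : j ≠ j') :
    signExpectation X Y ![i, i, i'] ![j', j, j] = 1 / 8 * ((1 + τ i) * (1 + σ j)) := by
  have hc := h.corr_left i j j' hj
  have hd := h.corr_right j i i' hi
  have hs := h.centreSign_sq hi j
  have ht := h.symm.centreSign_sq hj.symm i
  rw [signExpectation_eq h.left h.right, ← hc.integral_path hd (show (0 : Fin 3) ≠ 1 by decide)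
    (show (1 : Fin 3) ≠ 2 by decide) (centreSign X Y i i' j * centreSign Y X j' j i)
    (centreSign Y X j' j i), ← integral_const_mul]
  refine integral_congr_ae ?_
  filter_upwards [hc.right.ae_incr_fst_sq (show (0 : Fin 3) ≠ 1 by decide),
    hd.left.ae_incr_snd_sq (show (1 : Fin 3) ≠ 2 by decide),
    hd.right.ae_incr_snd_sq (show (1 : Fin 3) ≠ 2 by decide)] with ω hx hy hy'
  simp only [crossCount, limitSign, Matrix.cons_val, if_true, hi, hj.symm, if_false,
    h.centre_left i i' j' j, h.centre_right j' j i' i]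
  grind

end Patterns

section Swap

variable {ι κ : Type*} [DecidableEq ι] [DecidableEq κ]

lemma vec_comp_swap_fst {α : Type*} (a b c : α) : ![a, b, c] ∘ Equiv.swap 0 1 = ![b, a, c] := by
  ext k
  fin_cases k <;> simp [Equiv.swap_apply_of_ne_of_ne]

lemma vec_comp_swap_snd {α : Type*} (a b c : α) : ![a, b, c] ∘ Equiv.swap 1 2 = ![a, c, b] := by
  ext k
  fin_cases k <;> simp [Equiv.swap_apply_of_ne_of_ne]

lemma signExpectation_swap_fst (X : ι → Frame) (Y : κ → Frame) (a b c : ι) (a' b' c' : κ) :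
    signExpectation X Y ![b, a, c] ![b', a', c'] =
      signExpectation X Y ![a, b, c] ![a', b', c'] := by
  rw [← signExpectation_comp_perm X Y ![a, b, c] ![a', b', c'] (Equiv.swap 0 1),
    vec_comp_swap_fst, vec_comp_swap_fst]

lemma signExpectation_swap_snd (X : ι → Frame) (Y : κ → Frame) (a b c : ι) (a' b' c' : κ) :
    signExpectation X Y ![a, c, b] ![a', c', b'] =
      signExpectation X Y ![a, b, c] ![a', b', c'] := by
  rw [← signExpectation_comp_perm X Y ![a, b, c] ![a', b', c'] (Equiv.swap 1 2),
    vec_comp_swap_snd, vec_comp_swap_snd]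

lemma sum_signExpectation_comp_perm [Fintype κ] (X : ι → Frame) (Y : κ → Frame)
    (I : Fin 3 → ι) (π : Equiv.Perm (Fin 3)) :
    ∑ J, signExpectation X Y (I ∘ π) J = ∑ J, signExpectation X Y I J := by
  rw [← (π.symm.arrowCongr (Equiv.refl _)).sum_comp]
  exact Finset.sum_congr rfl fun J _ => signExpectation_comp_perm X Y I J π

end Swap

section Sum

variable {X Y : Fin 2 → Frame} {m : ℝ} {τ σ : Fin 2 → ℝ}

lemma sum_signExpectation_same (h : LimitData X Y m τ σ) (i : Fin 2) :
    ∑ J, signExpectation X Y ![i, i, i] J = 4 / 3 + 3 / 2 * (5 / 3 + τ i ^ 2) := by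
  have h01 := signExpectation_same_split h i (show (0 : Fin 2) ≠ 1 by decide)
  have h10 := signExpectation_same_split h i (show (1 : Fin 2) ≠ 0 by decide)
  simp only [sum_triples, Fin.sum_univ_two, signExpectation_same_same h i]
  rw [signExpectation_swap_snd X Y i i i 0 0 1, signExpectation_swap_fst X Y i i i 0 1 0,
    signExpectation_swap_snd X Y i i i 0 0 1, signExpectation_swap_snd X Y i i i 1 1 0,
    signExpectation_swap_fst X Y i i i 1 0 1, signExpectation_swap_snd X Y i i i 1 1 0, h01, h10]
  ring

lemma sum_signExpectation_split (h : LimitData X Y m τ σ) {i i' : Fin 2} (hi : i ≠ i') :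
    ∑ J, signExpectation X Y ![i, i, i'] J =
      1 / 4 * (10 / 3 + σ 0 ^ 2 + σ 1 ^ 2) + 2 + 1 / 4 * ((1 + τ i) * (2 + σ 0 + σ 1)) := by
  have hsame : ∀ j, signExpectation X Y ![i, i, i'] ![j, j, j] = 1 / 4 * (5 / 3 + σ j ^ 2) :=
    fun j => (signExpectation_swap X Y _ _).symm.trans (signExpectation_same_split h.symm j hi)
  have hsplit := fun {j j' : Fin 2} (hj : j ≠ j') => signExpectation_split_split h hi hj
  have hpath := fun {j j' : Fin 2} (hj : j ≠ j') => signExpectation_path h hi hj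
  have hpath' := fun {j j' : Fin 2} (hj : j ≠ j') =>
    (signExpectation_swap_fst X Y i i i' j' j j).trans (hpath hj)
  simp only [sum_triples, Fin.sum_univ_two, hsame, hsplit (zero_ne_one (α := Fin 2)),
    hsplit (one_ne_zero (α := Fin 2)), hpath (zero_ne_one (α := Fin 2)),
    hpath (one_ne_zero (α := Fin 2)), hpath' (zero_ne_one (α := Fin 2)),
    hpath' (one_ne_zero (α := Fin 2))]
  ring

lemma sum_signExpectation (h : LimitData X Y m τ σ) :
    ∑ I, ∑ J, signExpectation X Y I J =
      8 / 3 + 3 / 2 * (20 / 3 + τ 0 ^ 2 + τ 1 ^ 2 + σ 0 ^ 2 + σ 1 ^ 2) + 12 +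
        3 / 4 * ((2 + τ 0 + τ 1) * (2 + σ 0 + σ 1)) := by
  have hswap : ∀ a b c : Fin 2, ∑ J, signExpectation X Y ![a, c, b] J =
      ∑ J, signExpectation X Y ![a, b, c] J := fun a b c => by
    rw [← vec_comp_swap_snd, sum_signExpectation_comp_perm]
  have hswap' : ∀ a b c : Fin 2, ∑ J, signExpectation X Y ![b, a, c] J =
      ∑ J, signExpectation X Y ![a, b, c] J := fun a b c => by
    rw [← vec_comp_swap_fst, sum_signExpectation_comp_perm]
  simp only [sum_triples (fun I => ∑ J, signExpectation X Y I J), Fin.sum_univ_two,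
    sum_signExpectation_same h]
  rw [hswap 0 0 1, hswap' 0 1 0, hswap 0 0 1, hswap 1 1 0, hswap' 1 0 1, hswap 1 1 0,
    sum_signExpectation_split h zero_ne_one, sum_signExpectation_split h one_ne_zero]
  ring

end Sum

/-! ### The geometry of the drawing -/

namespace Frame

variable (F : Frame)

lemma det3_sq_eq_one : det3 F.c F.e F.f ^ 2 = 1 := by
  rw [det3, ← coe_basis, sq_eq_one_iff]
  exact (EuclideanSpace.basisFun (Fin 3) ℝ).det_to_matrix_orthonormalBasis_real F.basis

lemma det3_ce (w : E3) : det3 F.c F.e w = inner ℝ F.f w * det3 F.c F.e F.f := by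
  conv_lhs => rw [F.expand w]
  simp [det3_add_right, det3_smul_right]

lemma det3_cf (w : E3) : det3 F.c F.f w = -(inner ℝ F.e w * det3 F.c F.e F.f) := by
  conv_lhs => rw [F.expand w]
  simp [det3_add_right, det3_smul_right, det3_swap_right F.c F.e F.f]

/-- The component of `w` orthogonal to the centre: the tangent direction at the centre of the arc
to `w`. -/
def tangent (w : E3) : E3 := w - inner ℝ w F.c • F.c

lemma inner_c_tangent (w : E3) : inner ℝ F.c (F.tangent w) = 0 := by
  rw [tangent, inner_sub_right, real_inner_smul_right, real_inner_self_eq_norm_sq, F.norm_c,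
    real_inner_comm]
  ring

lemma inner_e_tangent (w : E3) : inner ℝ F.e (F.tangent w) = inner ℝ F.e w := by
  rw [tangent, inner_sub_right, real_inner_smul_right, real_inner_comm F.c F.e, F.inner_ce,
    mul_zero, sub_zero]

lemma inner_f_tangent (w : E3) : inner ℝ F.f (F.tangent w) = inner ℝ F.f w := by
  rw [tangent, inner_sub_right, real_inner_smul_right, real_inner_comm F.c F.f, F.inner_cf,
    mul_zero, sub_zero]

lemma inner_tangent (w w' : E3) : inner ℝ (F.tangent w) (F.tangent w') =
    det3 F.c F.e w * det3 F.c F.e w' + det3 F.c F.f w * det3 F.c F.f w' := by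
  rw [F.inner_of_tangent (F.inner_c_tangent w), inner_e_tangent, inner_e_tangent, inner_f_tangent,
    inner_f_tangent, F.det3_ce w, F.det3_ce w', F.det3_cf w, F.det3_cf w']
  linear_combination (-(inner ℝ F.f w * inner ℝ F.f w' + inner ℝ F.e w * inner ℝ F.e w')) *
    F.det3_sq_eq_one

lemma norm_tangent (w : E3) : ‖F.tangent w‖ = √(det3 F.c F.e w ^ 2 + det3 F.c F.f w ^ 2) := by
  rw [norm_eq_sqrt_real_inner, inner_tangent, sq, sq]

lemma norm_tangent_pos {u w : E3} (h : det3 F.c u w ≠ 0) : 0 < ‖F.tangent w‖ := by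
  rw [norm_pos_iff]
  intro h0
  rw [tangent, sub_eq_zero] at h0
  exact h (by rw [h0, det3_smul_right, det3_self_outer, mul_zero])

lemma cos_sphericalAngle (w w' : E3) :
    det3 F.c F.e w * det3 F.c F.e w' + det3 F.c F.f w * det3 F.c F.f w' =
      ‖F.tangent w‖ * ‖F.tangent w'‖ * Real.cos (sphericalAngle w F.c w') := by
  rw [← inner_tangent, mul_comm]
  exact (InnerProductGeometry.cos_angle_mul_norm_mul_norm _ _).symm

lemma height_eq (p : E3) (s : ℝ) : height F p s =
    det3 F.c F.e p * Real.cos (2 * Real.pi * s) + det3 F.c F.f p * Real.sin (2 * Real.pi * s) := by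
  simp only [height, dir, det3_add_mid, det3_smul_mid]
  ring

lemma isHeight_height {p : E3} (h : 0 < ‖F.tangent p‖) : IsHeight (height F p) := by
  rw [norm_tangent] at h
  refine ⟨continuous_det3 continuous_const (F.continuous_dir continuous_id) continuous_const,
    fun s => ?_⟩
  rw [← turn_trig_eq_zero h (-height F p s)]
  simp only [← height_eq, neg_add_eq_zero, eq_comm (a := height F p s)]

lemma hasCorrelation_height {p p' : E3} (h : 0 < ‖F.tangent p‖) (h' : 0 < ‖F.tangent p'‖) :
    HasCorrelation (height F p) (height F p')
      (1 - 2 * (sphericalAngle p F.c p' / Real.pi)) := by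
  refine ⟨F.isHeight_height h, F.isHeight_height h', fun s => ?_⟩
  have hθ := F.cos_sphericalAngle p p'
  rw [norm_tangent] at h h'
  rw [norm_tangent, norm_tangent] at hθ
  refine Eq.trans (integral_congr_ae (Eventually.of_forall fun x => ?_))
    (integral_sign_mul_sign_increment (InnerProductGeometry.angle_nonneg _ _)
      (InnerProductGeometry.angle_le_pi _ _) h h' hθ s)
  simp only [height_eq]
  ring_nf

end Frame

lemma exists_pos_forall_le {ι : Type*} [Finite ι] [Nonempty ι] {f : ι → ℝ} (h : ∀ i, 0 < f i) :
    ∃ m, 0 < m ∧ ∀ i, m ≤ f i :=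
  have ⟨i, hi⟩ := Finite.exists_min f
  ⟨f i, h i, hi⟩

section Margin

variable {ι κ : Type*} {X : ι → Frame} {Y : κ → Frame}

lemma Nondegenerate.mono {m m' : ℝ} (h : Nondegenerate X Y m) (h0 : 0 < m') (hm : m' ≤ m) :
    Nondegenerate X Y m' :=
  ⟨h0, fun i i' j hi => hm.trans (h.le_det3 i i' j hi), fun i j => hm.trans (h.le_tangent i j)⟩

lemma Nondegenerate.norm_tangent_pos {m : ℝ} (h : Nondegenerate X Y m) (i : ι) (j : κ) :
    0 < ‖(X i).tangent (Y j).c‖ := by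
  rw [Frame.norm_tangent]
  exact h.pos.trans_le (h.le_tangent i j)

lemma exists_nondegenerate [Finite ι] [Nontrivial ι] [Finite κ] [Nonempty κ]
    (h : ∀ i i' j, i ≠ i' → det3 (X i).c (X i').c (Y j).c ≠ 0) : ∃ m, Nondegenerate X Y m := by
  classical
  obtain ⟨m₁, h₁, hm₁⟩ := exists_pos_forall_le (ι := ι × ι × κ)
    (f := fun p => if p.1 = p.2.1 then 1 else |det3 (X p.1).c (X p.2.1).c (Y p.2.2).c|)
    (fun p => by
      split_ifs with hp
      · exact one_pos
      · exact abs_pos.2 (h _ _ _ hp))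
  obtain ⟨m₂, h₂, hm₂⟩ := exists_pos_forall_le (ι := ι × κ)
    (f := fun p => ‖(X p.1).tangent (Y p.2).c‖) (fun p =>
      have ⟨i', hi⟩ := exists_ne p.1
      (X p.1).norm_tangent_pos (h p.1 i' p.2 hi.symm))
  refine ⟨min m₁ m₂, lt_min h₁ h₂, fun i i' j hi => (min_le_left _ _).trans ?_,
    fun i j => (min_le_right _ _).trans ?_⟩
  · simpa [hi] using hm₁ (i, i', j)
  · rw [← Frame.norm_tangent]
    exact hm₂ (i, j)

end Margin

lemma sphericalAngle_comm (a b c : E3) : sphericalAngle a b c = sphericalAngle c b a :=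
  InnerProductGeometry.angle_comm _ _

lemma sphericalAngle_of_ne (w : Fin 2 → E3) (a : E3) {j j' : Fin 2} (h : j ≠ j') :
    sphericalAngle (w j) a (w j') = sphericalAngle (w 0) a (w 1) := by
  fin_cases j <;> fin_cases j' <;> first | exact absurd rfl h | rfl | exact sphericalAngle_comm ..

lemma centreSign_eq_of_zero_one {X Y : Fin 2 → Frame}
    (h : centreSign X Y 0 1 0 = centreSign X Y 0 1 1) (i i' j j' : Fin 2) :
    centreSign X Y i i' j = centreSign X Y i i' j' := by
  have hself : ∀ i j, centreSign X Y i i j = 0 := fun i j => by simp [centreSign]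
  have hswap : ∀ j, centreSign X Y 1 0 j = -centreSign X Y 0 1 j := fun j => by
    rw [centreSign, det3_swap_left, Real.sign_neg, centreSign]
  fin_cases i <;> fin_cases i' <;> fin_cases j <;> fin_cases j' <;> simp [hself, hswap, h]

lemma CrossSign.centreSign_eq {X Y : Fin 2 → Frame}
    (h : CrossSign (X 0).c (Y 1).c (X 1).c (Y 0).c) :
    centreSign X Y 0 1 0 = centreSign X Y 0 1 1 ∧ centreSign Y X 0 1 0 = centreSign Y X 0 1 1 := by
  obtain ⟨-, h₁, h₂, h₃⟩ := h
  simp only [centreSign, ← coe_sign_eq_realSign, det3_swap_left (Y 1).c, Left.sign_neg]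
  exact ⟨by rw [h₁], by rw [← h₂.symm.trans h₃]⟩

lemma LimitData.of_crossSign {X Y : Fin 2 → Frame} {m : ℝ} (hX : Nondegenerate X Y m)
    (hY : Nondegenerate Y X m) (h : CrossSign (X 0).c (Y 1).c (X 1).c (Y 0).c) :
    LimitData X Y m (fun i => 1 - 2 * (sphericalAngle (Y 0).c (X i).c (Y 1).c / Real.pi))
      (fun j => 1 - 2 * (sphericalAngle (X 0).c (Y j).c (X 1).c / Real.pi)) where
  left := hX
  right := hY
  corr_left i j j' hj := by
    rw [← sphericalAngle_of_ne (fun j => (Y j).c) (X i).c hj]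
    exact (X i).hasCorrelation_height (hX.norm_tangent_pos i j) (hX.norm_tangent_pos i j')
  corr_right j i i' hi := by
    rw [← sphericalAngle_of_ne (fun i => (X i).c) (Y j).c hi]
    exact (Y j).hasCorrelation_height (hY.norm_tangent_pos j i) (hY.norm_tangent_pos j i')
  centre_left := centreSign_eq_of_zero_one h.centreSign_eq.1
  centre_right := centreSign_eq_of_zero_one h.centreSign_eq.2

lemma IsAntipodalDrawing.exists_limitData {v w : Fin 2 → E3} {X Y : Fin 2 → Frame}
    (hX : ∀ i, (X i).c = v i) (hY : ∀ i, (Y i).c = w i) (hD : IsAntipodalDrawing v w)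
    (hcross : (openArc (v 0) (w 1) ∩ openArc (v 1) (w 0)).Nonempty) :
    ∃ m, LimitData X Y m (fun i => 1 - 2 * (sphericalAngle (w 0) (v i) (w 1) / Real.pi))
      (fun j => 1 - 2 * (sphericalAngle (v 0) (w j) (v 1) / Real.pi)) := by
  obtain rfl : (fun i => (X i).c) = v := funext hX
  obtain rfl : (fun i => (Y i).c) = w := funext hY
  have hx : ∀ i i' j, i ≠ i' → det3 (X i).c (X i').c (Y j).c ≠ 0 := fun i i' j hi =>
    det3_ne_zero (hD.generalPosition (.inl i) (.inl i') (.inr j) (by simpa) (by simp) (by simp))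
  have hy : ∀ i i' j, i ≠ i' → det3 (Y i).c (Y i').c (X j).c ≠ 0 := fun i i' j hi =>
    det3_ne_zero (hD.generalPosition (.inr i) (.inr i') (.inl j) (by simpa) (by simp) (by simp))
  obtain ⟨m₁, hm₁⟩ := exists_nondegenerate hx
  obtain ⟨m₂, hm₂⟩ := exists_nondegenerate hy
  have hm := lt_min hm₁.pos hm₂.pos
  exact ⟨min m₁ m₂, .of_crossSign (hm₁.mono hm (min_le_left _ _)) (hm₂.mono hm (min_le_right _ _))
    (crossSign_of_nonempty (hx 0 1 1 zero_ne_one) hcross)⟩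

end

end SphericalDrawing

theorem theorem4 (v₁ v₂ w₁ w₂ : E3)
    (hD : IsAntipodalDrawing ![v₁, v₂] ![w₁, w₂])
    -- the labelling of the vertices: the edges `v₁ w₂` and `v₂ w₁` cross
    (hcross : (openArc v₁ w₂ ∩ openArc v₂ w₁).Nonempty)
    (α β γ δ : ℝ)
    (hα : α = sphericalAngle v₂ w₂ v₁) (hβ : β = sphericalAngle w₂ v₂ w₁)
    (hγ : γ = sphericalAngle w₁ v₁ w₂) (hδ : δ = sphericalAngle v₁ w₁ v₂) :
    ∃ C r₀ : ℝ, 0 < r₀ ∧ ∀ ρ : ℝ, 0 ≤ ρ → ρ < r₀ →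
      ∃ t : ℝ,
        |t - (3 / (2 ^ 12 * Real.pi ^ 2) *
              ((2 * Real.pi - α - δ) * (2 * Real.pi - γ - β)
                + 2 * (α ^ 2 + β ^ 2 + γ ^ 2 + δ ^ 2)
                - 2 * Real.pi * (α + β + γ + δ))
            + 23 / (3 * 2 ^ 10))| ≤ C * ρ ∧
        ∀ (r : ℕ → ℝ) (P Q : (n : ℕ) → Fin 2 × Bool → Fin n → E3),
          (∀ n, 1 ≤ n → 0 < r n) → Tendsto r atTop (𝓝 ρ) →
          (∀ n, 1 ≤ n → IsBlowup ![v₁, v₂] ![w₁, w₂] (r n) n (P n) (Q n)) →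
          Tendsto (fun n => triangleDensity (P n) (Q n)) atTop (𝓝 t) := by
  choose X hX using fun i => exists_frame (hD.norm_left i)
  choose Y hY using fun j => exists_frame (hD.norm_right j)
  obtain ⟨m, hm⟩ := hD.exists_limitData hX hY hcross
  have hpos := hm.left.pos
  refine ⟨216 / m, min (m / 3) Real.pi, lt_min (by positivity) Real.pi_pos, fun ρ h0 hρ => ?_⟩
  have h1 : 3 * ρ < m := by linarith [hρ.trans_le (min_le_left _ _)]
  have h2 : ρ < Real.pi := hρ.trans_le (min_le_right _ _)
  refine ⟨limitDensity X Y ρ, ?_, fun r P Q hr hlim hB =>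
    tendsto_triangleDensity hm.left hm.right h0 h1 h2 hX hY hr hlim hB⟩
  refine le_of_eq_of_le ?_ (abs_limitDensity_sub_le hm.left hm.right h0 h1)
  congr 2
  rw [limitDensity_zero, sum_signExpectation hm]
  simp only [Matrix.cons_val_zero, Matrix.cons_val_one]
  rw [sphericalAngle_comm w₁ v₂ w₂, sphericalAngle_comm v₁ w₂ v₂, ← hα, ← hβ, ← hγ, ← hδ]
  field_simp
  ring
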